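/- Let $(Y_t)_{0\le t\le 1}$ be a standard real Brownian motion (so $Y_0=0$ almost surely), and let $\Psi(Y)_t := Y_t - tY_1$, $0\le t\le 1$, be its bridge. For a function $z:[0,1]\to\mathbb{R}$ and an integer $n\ge 1$ put $\Delta_i^n z := z(i/n)-z((i-1)/n)$ for $1\le i\le n$, and let $$\widehat S_n(z) := \frac{\sum_{i=1}^{n-1} |\Delta_i^n z|\,|\Delta_{i+1}^n z|}{\sum_{i=1}^{n} |\Delta_i^n z|^2}$$ be the normalized realized bivariation of $z$ (with the convention that the quotient is $0$ when the denominator vanishes). Then, as $n\to\infty$, $$\sqrt{n}\left(\widehat S_n(\Psi(Y))-\frac{2}{\pi}\right)\ \longrightarrow\ \mathcal{N}\left(0,\ 1+\frac{4}{\pi}-\frac{20}{\pi^2}\right)\quad\text{in distribution.}$$ -/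

import Mathlib

open MeasureTheory ProbabilityTheory Filter
open scoped NNReal unitInterval

/-- A standard real Brownian motion `(Y_t)_{0 ≤ t ≤ 1}` under `P`: it starts at `0`, has
independent increments, `Y_t - Y_s` has law `N(0, t - s)` for `s ≤ t`, and its paths are almost
surely continuous. -/
structure IsBrownianOnUnit {Ω : Type*} [MeasurableSpace Ω] (Y : I → Ω → ℝ) (P : Measure Ω) :
    Prop where
  start_zero : ∀ᵐ ω ∂P, Y 0 ω = 0
  indep_increments : HasIndepIncrements Y P
  law_increment : ∀ s t : I, s ≤ t →
    HasLaw (fun ω ↦ Y t ω - Y s ω) (gaussianReal 0 (Real.toNNReal ((t : ℝ) - (s : ℝ)))) P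
  continuous_paths : ∀ᵐ ω ∂P, Continuous (fun t ↦ Y t ω)

/-- The bridge map `Ψ(x)(t) = x(t) - t x(1)` on functions `x : [0,1] → ℝ`. -/
def bridgeMap (x : I → ℝ) : I → ℝ := fun t ↦ x t - (t : ℝ) * x 1

/-- The point `i / n` of `[0,1]`; it is only used for `i ≤ n`, where the projection onto `[0,1]`
does nothing (see `coe_gridPoint`). -/
noncomputable def gridPoint (n i : ℕ) : I :=
  Set.projIcc (0 : ℝ) 1 zero_le_one ((i : ℝ) / (n : ℝ))

theorem coe_gridPoint {n i : ℕ} (h : i ≤ n) : (gridPoint n i : ℝ) = (i : ℝ) / (n : ℝ) := by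
  have h1 : (i : ℝ) / (n : ℝ) ∈ Set.Icc (0 : ℝ) 1 :=
    ⟨by positivity, div_le_one_of_le₀ (by exact_mod_cast h) (by positivity)⟩
  rw [gridPoint, Set.projIcc_of_mem zero_le_one h1]

/-- The increment `Δ_i^n x = x(i/n) - x((i-1)/n)`, for `1 ≤ i ≤ n`. -/
noncomputable def gridIncrement (n : ℕ) (x : I → ℝ) (i : ℕ) : ℝ :=
  x (gridPoint n i) - x (gridPoint n (i - 1))

/-- The realized bivariation `∑_{i=1}^{n-1} |Δ_i^n x| |Δ_{i+1}^n x|`. -/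
noncomputable def realizedBivariation (n : ℕ) (x : I → ℝ) : ℝ :=
  ∑ i ∈ Finset.Icc 1 (n - 1), |gridIncrement n x i| * |gridIncrement n x (i + 1)|

/-- The realized quadratic variation `∑_{i=1}^{n} |Δ_i^n x|^2`. -/
noncomputable def realizedQuadraticVariation (n : ℕ) (x : I → ℝ) : ℝ :=
  ∑ i ∈ Finset.Icc 1 n, |gridIncrement n x i| ^ 2

/-- The normalized realized bivariation: the quotient of the two sums above. -/
noncomputable def normalizedBivariation (n : ℕ) (x : I → ℝ) : ℝ :=
  realizedBivariation n x / realizedQuadraticVariation n x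

theorem limitVariance_nonneg : 0 ≤ 1 + 4 / Real.pi - 20 / Real.pi ^ 2 := by
  have h := Real.pi_gt_three
  have h2 : 1 + 4 / Real.pi - 20 / Real.pi ^ 2
      = (Real.pi ^ 2 + 4 * Real.pi - 20) / Real.pi ^ 2 := by
    field_simp
  rw [h2]
  exact div_nonneg (by nlinarith) (by positivity)

/-- The number `1 + 4/π - 20/π²` as a nonnegative real. -/
noncomputable def limitVariance : ℝ≥0 :=
  ⟨1 + 4 / Real.pi - 20 / Real.pi ^ 2, limitVariance_nonneg⟩

/-! Write κ = √(2/π) for `gaussianAbsMean`. The rescaled increments X_i of Y on the grid are i.i.d.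
standard normal, and passing to the bridge subtracts their sample mean from each of them. With B and
Q the bivariation and the sum of squares of the centered sequence, the statistic is √n (B/Q - κ²),
that is n^{-1/2} (B - κ² Q) divided by Q/n as long as Q ≠ 0. Since Q/n → 1 in measure, Slutsky's
lemma leaves only the numerator.

Centering is negligible in the numerator. It changes Q by n times the squared sample mean, which is
bounded in mean. To first order it changes B by the sample mean, of order n^{-1/2}, times sums of
|X_i| sign(X_{i+1}) and |X_{i+1}| sign(X_i); the sign is centered, so these sums are of order √n
only. The kink of |x| matters only for X_i close to 0, and there are few of those
(`abs_bivariationSum_sub_le`, `integral_centeringError_le`).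

Without centering, B - κ² Q is up to boundary terms a sum of c(X_i) c(X_{i+1}) + ℓ(X_{i+1}), with c
= `centeredAbs` and ℓ = `linearPart` of mean zero (`bivariationSum_sub_squareSum_eq`). These terms
are pairwise orthogonal and 1-dependent. Dropping one term in q + 1 leaves i.i.d. blocks, to which
the classical central limit theorem applies, and the dropped terms carry a share of about 1/(q + 1)
of the variance; letting q → ∞ gives `tendstoInDistribution_sum_pairTerm`. Gaussian moments then
yield the variance (`pairVariance_centeredAbs`). -/

/-! ### Second moments of sums over pairs of i.i.d. variables -/

section IIDSums

variable {Ω : Type*} [MeasurableSpace Ω] {P : Measure Ω} {X : ℕ → Ω → ℝ} {γ : Measure ℝ}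

/-- The random variable `a (X i) * b (X j) + d (X j)`. -/
def pairTerm (a b d : ℝ → ℝ) (X : ℕ → Ω → ℝ) (i j : ℕ) (ω : Ω) : ℝ :=
  a (X i ω) * b (X j ω) + d (X j ω)

/-- The second moment of `pairTerm a b d X i j` for independent `X i`, `X j` with law `γ`. -/
noncomputable def pairVariance (a b d : ℝ → ℝ) (γ : Measure ℝ) : ℝ :=
  (∫ x, a x ^ 2 ∂γ) * (∫ x, b x ^ 2 ∂γ) + 2 * (∫ x, a x ∂γ) * (∫ x, b x * d x ∂γ) +
    ∫ x, d x ^ 2 ∂γ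

variable {a b d : ℝ → ℝ}

@[fun_prop]
lemma measurable_pairTerm (hX : ∀ i, Measurable (X i)) (ha : Measurable a) (hb : Measurable b)
    (hd : Measurable d) (i j : ℕ) : Measurable (pairTerm a b d X i j) := by
  unfold pairTerm
  have := hX i
  have := hX j
  fun_prop

lemma memLp_comp_of_hasLaw {f : ℝ → ℝ} {p : ENNReal} (hlaw : ∀ i, HasLaw (X i) γ P)
    (hf : MemLp f p γ) (i : ℕ) : MemLp (fun ω ↦ f (X i ω)) p P := by
  have h := hf
  rw [← (hlaw i).map_eq] at h
  exact h.comp_of_map (hlaw i).aemeasurable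

lemma integral_comp_of_hasLaw {f : ℝ → ℝ} (hlaw : ∀ i, HasLaw (X i) γ P)
    (hf : Measurable f) (i : ℕ) : ∫ ω, f (X i ω) ∂P = ∫ x, f x ∂γ :=
  (hlaw i).integral_comp hf.aestronglyMeasurable

lemma ProbabilityTheory.IndepFun.memLp_two_mul {U V : Ω → ℝ} (h : IndepFun U V P)
    (hU : MemLp U 2 P) (hV : MemLp V 2 P) : MemLp (fun ω ↦ U ω * V ω) 2 P := by
  refine (memLp_two_iff_integrable_sq (hU.1.mul hV.1)).2 ?_
  simp only [Pi.mul_apply, mul_pow]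
  exact (h.comp (φ := fun x ↦ x ^ 2) (ψ := fun x ↦ x ^ 2) (by fun_prop)
    (by fun_prop)).integrable_mul hU.integrable_sq hV.integrable_sq

section

variable [IsProbabilityMeasure P]
  (hX : ∀ i, Measurable (X i)) (hind : iIndepFun X P) (hlaw : ∀ i, HasLaw (X i) γ P)
  (ha : Measurable a) (hb : Measurable b) (hd : Measurable d)
  (ha2 : MemLp a 2 γ) (hb2 : MemLp b 2 γ) (hd2 : MemLp d 2 γ)

omit [IsProbabilityMeasure P] in
include hind hlaw ha hb ha2 hb2 hd2 in
lemma memLp_pairTerm {i j : ℕ} (hij : i ≠ j) : MemLp (pairTerm a b d X i j) 2 P :=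
  (((hind.indepFun hij).comp ha hb).memLp_two_mul (memLp_comp_of_hasLaw hlaw ha2 i)
    (memLp_comp_of_hasLaw hlaw hb2 j)).add (memLp_comp_of_hasLaw hlaw hd2 j)

include hind hlaw ha hb hd ha2 hb2 hd2 in
lemma integral_pairTerm (hb0 : ∫ x, b x ∂γ = 0) (hd0 : ∫ x, d x ∂γ = 0) {i j : ℕ} (hij : i ≠ j) :
    ∫ ω, pairTerm a b d X i j ω ∂P = 0 := by
  have hi := (hind.indepFun hij).comp ha hb
  have h1 : Integrable (fun ω ↦ a (X i ω) * b (X j ω)) P :=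
    (hi.memLp_two_mul (memLp_comp_of_hasLaw hlaw ha2 i)
      (memLp_comp_of_hasLaw hlaw hb2 j)).integrable (by norm_num)
  have h2 := (memLp_comp_of_hasLaw hlaw hd2 j).integrable (by norm_num)
  unfold pairTerm
  rw [integral_add h1 h2, integral_comp_of_hasLaw hlaw hd, hd0, add_zero]
  have := hi.integral_fun_mul_eq_mul_integral
    (memLp_comp_of_hasLaw hlaw ha2 i).1 (memLp_comp_of_hasLaw hlaw hb2 j).1
  simp only [Function.comp_apply] at this
  rw [this, integral_comp_of_hasLaw hlaw hb, hb0, mul_zero]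

include hind hlaw ha hb hd ha2 hb2 hd2 in
lemma integral_pairTerm_sq {i j : ℕ} (hij : i ≠ j) :
    ∫ ω, pairTerm a b d X i j ω ^ 2 ∂P = pairVariance a b d γ := by
  have hA := memLp_comp_of_hasLaw hlaw ha2 i
  have hB := memLp_comp_of_hasLaw hlaw hb2 j
  have hD := memLp_comp_of_hasLaw hlaw hd2 j
  have h1 := ((hind.indepFun hij).comp ha hb).memLp_two_mul hA hB
  have e : ∀ ω, pairTerm a b d X i j ω ^ 2 = a (X i ω) ^ 2 * b (X j ω) ^ 2 +
      2 * (a (X i ω) * (b (X j ω) * d (X j ω))) + d (X j ω) ^ 2 := fun ω ↦ by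
    unfold pairTerm; ring
  have hAB := (hind.indepFun hij).comp (ha.pow_const 2) (hb.pow_const 2)
  have hAD := (hind.indepFun hij).comp ha (hb.mul hd)
  have iBD : Integrable (fun ω ↦ b (X j ω) * d (X j ω)) P := hB.integrable_mul hD
  have i1 : Integrable (fun ω ↦ a (X i ω) ^ 2 * b (X j ω) ^ 2) P :=
    hAB.integrable_mul hA.integrable_sq hB.integrable_sq
  have i2 : Integrable (fun ω ↦ 2 * (a (X i ω) * (b (X j ω) * d (X j ω)))) P :=
    (hAD.integrable_mul (hA.integrable (by norm_num)) iBD).const_mul 2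
  have e1 := hAB.integral_fun_mul_eq_mul_integral hA.integrable_sq.1 hB.integrable_sq.1
  have e2 := hAD.integral_fun_mul_eq_mul_integral hA.1 iBD.1
  simp only [Function.comp_apply, Pi.mul_apply] at e1 e2
  simp_rw [e]
  rw [integral_add (f := fun ω ↦ a (X i ω) ^ 2 * b (X j ω) ^ 2 +
      2 * (a (X i ω) * (b (X j ω) * d (X j ω)))) (i1.add i2) hD.integrable_sq, integral_add i1 i2, integral_const_mul, e1, e2,
    integral_comp_of_hasLaw (f := fun x ↦ a x ^ 2) hlaw (ha.pow_const 2),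
    integral_comp_of_hasLaw (f := fun x ↦ b x ^ 2) hlaw (hb.pow_const 2),
    integral_comp_of_hasLaw (f := fun x ↦ d x ^ 2) hlaw (hd.pow_const 2),
    integral_comp_of_hasLaw (f := fun x ↦ b x * d x) hlaw (hb.mul hd),
    integral_comp_of_hasLaw hlaw ha, pairVariance]
  ring

include hX hind hlaw ha hb hd ha2 hb2 hd2 in
/-- Two terms are orthogonal as soon as the second index of one of them is new. -/
lemma integral_pairTerm_mul_pairTerm (hb0 : ∫ x, b x ∂γ = 0) (hd0 : ∫ x, d x ∂γ = 0)
    {i i' j j' : ℕ} (hi : i ≠ i') (h1 : i ≠ j') (h2 : i' ≠ j') (h3 : j ≠ j') :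
    ∫ ω, pairTerm a b d X i i' ω * pairTerm a b d X j j' ω ∂P = 0 := by
  have hW := memLp_pairTerm hind hlaw ha hb ha2 hb2 hd2 hi
  -- Only j' has to be new: j may equal i or i'. Hence everything except X j' is grouped into a
  -- single vector.
  have hI := hind.indepFun_finset {i, i', j} {j'} (by simp [h1.symm, h2.symm, h3.symm]) hX
  have hA := memLp_comp_of_hasLaw hlaw ha2 j
  have hB := memLp_comp_of_hasLaw hlaw hb2 j'
  have hD := memLp_comp_of_hasLaw hlaw hd2 j'
  have hWA : Integrable (fun ω ↦ pairTerm a b d X i i' ω * a (X j ω)) P := hW.integrable_mul hA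
  have hi1 : IndepFun (fun ω ↦ pairTerm a b d X i i' ω * a (X j ω)) (fun ω ↦ b (X j' ω)) P :=
    hI.comp (φ := fun v : ({i, i', j} : Finset ℕ) → ℝ ↦ (a (v ⟨i, by simp⟩) * b (v ⟨i', by simp⟩) + d (v ⟨i', by simp⟩)) *
      a (v ⟨j, by simp⟩)) (ψ := fun v : ({j'} : Finset ℕ) → ℝ ↦ b (v ⟨j', by simp⟩)) (by fun_prop) (by fun_prop)
  have hi2 : IndepFun (fun ω ↦ pairTerm a b d X i i' ω) (fun ω ↦ d (X j' ω)) P :=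
    hI.comp (φ := fun v : ({i, i', j} : Finset ℕ) → ℝ ↦ (a (v ⟨i, by simp⟩) * b (v ⟨i', by simp⟩) + d (v ⟨i', by simp⟩)))
      (ψ := fun v : ({j'} : Finset ℕ) → ℝ ↦ d (v ⟨j', by simp⟩)) (by fun_prop) (by fun_prop)
  have e : ∀ ω, pairTerm a b d X i i' ω * pairTerm a b d X j j' ω =
      pairTerm a b d X i i' ω * a (X j ω) * b (X j' ω) + pairTerm a b d X i i' ω * d (X j' ω) :=
    fun ω ↦ by simp only [pairTerm]; ring
  simp_rw [e]
  have i1 : Integrable (fun ω ↦ pairTerm a b d X i i' ω * a (X j ω) * b (X j' ω)) P :=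
    hi1.integrable_mul hWA (hB.integrable (by norm_num))
  have i2 : Integrable (fun ω ↦ pairTerm a b d X i i' ω * d (X j' ω)) P := hW.integrable_mul hD
  rw [integral_add i1 i2,
    hi1.integral_fun_mul_eq_mul_integral hWA.1 hB.1, hi2.integral_fun_mul_eq_mul_integral hW.1 hD.1,
    integral_comp_of_hasLaw hlaw hb, integral_comp_of_hasLaw hlaw hd, hb0, hd0]
  simp

include hX hind hlaw ha hb hd ha2 hb2 hd2 in
-- Of two distinct terms, one has a second index that the other does not contain, so all mixed
-- products integrate to zero. The index maps `e`, `f` allow pairs in either order, as well as sums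
-- of `d` alone.
lemma integral_sum_pairTerm_sq (hb0 : ∫ x, b x ∂γ = 0) (hd0 : ∫ x, d x ∂γ = 0)
    {ι : Type*} (s : Finset ι) (e f : ι → ℕ) (hef : ∀ k ∈ s, e k ≠ f k)
    (hs : ∀ k ∈ s, ∀ l ∈ s, k ≠ l →
      (e k ≠ f l ∧ f k ≠ f l) ∨ (e l ≠ f k ∧ f l ≠ f k)) :
    ∫ ω, (∑ k ∈ s, pairTerm a b d X (e k) (f k) ω) ^ 2 ∂P = s.card * pairVariance a b d γ := by
  have hL : ∀ k ∈ s, MemLp (pairTerm a b d X (e k) (f k)) 2 P := fun k hk ↦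
    memLp_pairTerm hind hlaw ha hb ha2 hb2 hd2 (hef k hk)
  have hI : ∀ k ∈ s, ∀ l ∈ s, Integrable (fun ω ↦ pairTerm a b d X (e k) (f k) ω *
      pairTerm a b d X (e l) (f l) ω) P := fun k hk l hl ↦ (hL k hk).integrable_mul (hL l hl)
  simp_rw [sq, Finset.sum_mul_sum]
  rw [integral_finsetSum _ fun k hk ↦ integrable_finsetSum _ fun l hl ↦ hI k hk l hl]
  have : ∀ k ∈ s, ∫ ω, ∑ l ∈ s, pairTerm a b d X (e k) (f k) ω * pairTerm a b d X (e l) (f l) ω ∂P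
      = pairVariance a b d γ := by
    intro k hk
    rw [integral_finsetSum _ fun l hl ↦ hI k hk l hl,
      Finset.sum_eq_single_of_mem k hk]
    · simp_rw [← sq]
      exact integral_pairTerm_sq hind hlaw ha hb hd ha2 hb2 hd2 (hef k hk)
    · intro l hl hlk
      rcases hs k hk l hl hlk.symm with h | h
      · exact integral_pairTerm_mul_pairTerm hX hind hlaw ha hb hd ha2 hb2 hd2 hb0 hd0
          (hef k hk) h.1 h.2 (hef l hl)
      · simp_rw [mul_comm (pairTerm a b d X (e k) (f k) _)]
        exact integral_pairTerm_mul_pairTerm hX hind hlaw ha hb hd ha2 hb2 hd2 hb0 hd0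
          (hef l hl) h.1 h.2 (hef k hk)
  rw [Finset.sum_congr rfl this, Finset.sum_const, nsmul_eq_mul]

end

end IIDSums

/-! ### Convergence in distribution by approximation in mean -/

section Approximation

variable {Ω : Type*} [MeasurableSpace Ω] {P : Measure Ω} [IsProbabilityMeasure P]

/-- The map θ ↦ exp(iθ) is 1-Lipschitz; the factor exp(itV) of modulus one is pulled out. -/
lemma norm_charFun_map_sub_charFun_map_le {U V : Ω → ℝ} (hU : AEMeasurable U P)
    (hV : AEMeasurable V P) (hUV : Integrable (fun ω ↦ U ω - V ω) P) (t : ℝ) :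
    ‖charFun (P.map U) t - charFun (P.map V) t‖ ≤ |t| * ∫ ω, |U ω - V ω| ∂P := by
  have hm : ∀ {W : Ω → ℝ}, AEMeasurable W P →
      Integrable (fun ω ↦ Complex.exp (t * W ω * Complex.I)) P := fun hW ↦ by
    refine Integrable.of_bound (by fun_prop) 1 (ae_of_all _ fun ω ↦ ?_)
    rw [← Complex.ofReal_mul, Complex.norm_exp_ofReal_mul_I]
  simp_rw [charFun_apply_real]
  rw [integral_map hU (by fun_prop), integral_map hV (by fun_prop),
    ← integral_sub (hm hU) (hm hV), ← integral_const_mul]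
  refine norm_integral_le_of_norm_le (hUV.abs.const_mul _) (ae_of_all _ fun ω ↦ ?_)
  have e : Complex.exp (t * U ω * Complex.I) - Complex.exp (t * V ω * Complex.I) =
      Complex.exp ((t * V ω : ℝ) * Complex.I) *
        (Complex.exp (Complex.I * (t * (U ω - V ω) : ℝ)) - 1) := by
    rw [mul_sub, ← Complex.exp_add]
    push_cast
    ring_nf
  rw [e, norm_mul, Complex.norm_exp_ofReal_mul_I, one_mul, ← abs_mul]
  exact Real.norm_exp_I_mul_ofReal_sub_one_le

lemma integral_abs_le_sqrt_integral_sq {U : Ω → ℝ} (hU : MemLp U 2 P) :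
    ∫ ω, |U ω| ∂P ≤ √(∫ ω, U ω ^ 2 ∂P) := by
  have h := variance_nonneg (fun ω ↦ |U ω|) P
  rw [variance_eq_sub (X := fun ω ↦ |U ω|) hU.abs] at h
  simp only [Pi.pow_apply, sq_abs] at h
  exact Real.le_sqrt_of_sq_le (by linarith)

/-- Convergence in distribution through approximations: it suffices that the characteristic
functions of approximations `T q n`, uniformly close in mean to `S n`, converge. -/
lemma tendstoInDistribution_of_approx {S : ℕ → Ω → ℝ} {T : ℕ → ℕ → Ω → ℝ} {μ : Measure ℝ}
    [IsProbabilityMeasure μ] {φ : ℕ → ℝ → ℂ} {δ : ℕ → ℝ}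
    (hS : ∀ n, AEMeasurable (S n) P) (hT : ∀ q n, AEMeasurable (T q n) P)
    (hST : ∀ q n, Integrable (fun ω ↦ S n ω - T q n ω) P)
    (hTφ : ∀ q t, Tendsto (fun n ↦ charFun (P.map (T q n)) t) atTop (nhds (φ q t)))
    (hφ : ∀ t, Tendsto (fun q ↦ φ q t) atTop (nhds (charFun μ t)))
    (hδ : Tendsto δ atTop (nhds 0))
    (hle : ∀ q, ∀ᶠ n in atTop, ∫ ω, |S n ω - T q n ω| ∂P ≤ δ q) :
    TendstoInDistribution S atTop (fun z : ℝ ↦ z) (fun _ ↦ P) μ where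
  forall_aemeasurable := hS
  tendsto := by
    refine ProbabilityMeasure.tendsto_iff_tendsto_charFun.2 fun t ↦ ?_
    simp only [ProbabilityMeasure.coe_mk, Measure.map_id']
    rw [Metric.tendsto_nhds]
    intro ε hε
    have h1 : Tendsto (fun q ↦ |t| * δ q) atTop (nhds 0) := by simpa using hδ.const_mul |t|
    obtain ⟨q, hq1, hq2⟩ := ((h1.eventually_lt_const (show 0 < ε / 3 by positivity)).and
      (Metric.tendsto_nhds.1 (hφ t) (ε / 3) (by positivity))).exists
    filter_upwards [hle q, Metric.tendsto_nhds.1 (hTφ q t) (ε / 3) (by positivity)] with n h2 h3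
    have h4 := norm_charFun_map_sub_charFun_map_le (hS n) (hT q n) (hST q n) t
    rw [← dist_eq_norm] at h4
    have h5 := mul_le_mul_of_nonneg_left h2 (abs_nonneg t)
    linarith [dist_triangle4 (charFun (P.map (S n)) t) (charFun (P.map (T q n)) t) (φ q t)
      (charFun μ t)]

end Approximation

/-! ### Cutting the index set into blocks -/

section Blocks

variable {Ω : Type*} [MeasurableSpace Ω] {P : Measure Ω}

/-- Grouping independent random variables yields independent random vectors. -/
lemma ProbabilityTheory.iIndepFun.curry {ι κ E : Type*} [MeasurableSpace E]
    {X : ι × κ → Ω → E} (hX : ∀ p, Measurable (X p)) (h : iIndepFun X P) :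
    iIndepFun (fun i ω j ↦ X (i, j) ω) P := by
  have := h.isProbabilityMeasure
  have hp : ∀ i j, IsProbabilityMeasure (P.map (X (i, j))) := fun i j ↦
    Measure.isProbabilityMeasure_map (hX _).aemeasurable
  rw [iIndepFun_iff_map_fun_eq_infinitePi_map (by fun_prop)] at h ⊢
  have h1 := congrArg (Measure.map (MeasurableEquiv.curry ι κ E)) h
  rw [Measure.map_map (by fun_prop) (by fun_prop),
    Measure.infinitePi_map_curry (fun i j ↦ P.map (X (i, j)))] at h1
  have h2 : (MeasurableEquiv.curry ι κ E) ∘ (fun ω p ↦ X p ω) = fun ω i j ↦ X (i, j) ω := rfl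
  rw [h2] at h1
  rw [h1]
  congr 1
  funext i
  have h3 := congrArg (Measure.map (fun (v : ι → κ → E) ↦ v i)) h1
  rw [Measure.map_map (by fun_prop) (by fun_prop), Measure.infinitePi_map_eval] at h3
  exact h3.symm

/-- The sum of the consecutive terms `a (y r) * b (y (r + 1)) + d (y (r + 1))` of a vector. -/
def blockSum (a b d : ℝ → ℝ) (q : ℕ) (y : Fin (q + 1) → ℝ) : ℝ :=
  ∑ r : Fin q, (a (y r.castSucc) * b (y r.succ) + d (y r.succ))

variable {a b d : ℝ → ℝ}

lemma measurable_blockSum (ha : Measurable a) (hb : Measurable b) (hd : Measurable d) (q : ℕ) :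
    Measurable (blockSum a b d q) := by
  unfold blockSum
  fun_prop

omit [MeasurableSpace Ω] in
lemma blockSum_eq_sum_pairTerm (X : ℕ → Ω → ℝ) (q j : ℕ) (ω : Ω) :
    blockSum a b d q (fun r ↦ X (j * (q + 1) + r) ω) =
      ∑ r ∈ Finset.range q,
        pairTerm a b d X (j * (q + 1) + r) (j * (q + 1) + r + 1) ω := by
  rw [Finset.sum_range]
  rfl

/-- A block of q + 1 variables contains q consecutive pairs. The pair starting at residue q
straddles two blocks and is omitted, as is everything in the incomplete last block. -/
lemma sum_blocks_eq_sum_filter (F : ℕ → ℝ) (n q : ℕ) :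
    ∑ j ∈ Finset.range (n / (q + 1)), ∑ r ∈ Finset.range q, F (j * (q + 1) + r) =
      ∑ i ∈ Finset.range n with i % (q + 1) ≠ q ∧ i / (q + 1) < n / (q + 1), F i := by
  rw [← Finset.sum_product' (f := fun j r ↦ F (j * (q + 1) + r))]
  have key : ∀ j r, r < q → (j * (q + 1) + r) / (q + 1) = j ∧ (j * (q + 1) + r) % (q + 1) = r := by
    intro j r hr
    rw [mul_comm j, Nat.mul_add_div (by omega), Nat.mul_add_mod, Nat.div_eq_of_lt (by omega),
      Nat.mod_eq_of_lt (by omega)]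
    exact ⟨rfl, rfl⟩
  refine Finset.sum_nbij' (fun p ↦ p.1 * (q + 1) + p.2) (fun i ↦ (i / (q + 1), i % (q + 1)))
    ?_ ?_ ?_ ?_ ?_
  · rintro ⟨j, r⟩ h
    simp only [Finset.mem_product, Finset.mem_range, Finset.mem_filter] at h ⊢
    obtain ⟨h1, h2⟩ := key j r h.2
    refine ⟨?_, by omega, by omega⟩
    exact Nat.lt_of_div_lt_div (by rw [h1]; exact h.1)
  · intro i h
    simp only [Finset.mem_product, Finset.mem_range, Finset.mem_filter] at h ⊢
    have := Nat.mod_lt i (show 0 < q + 1 by omega)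
    omega
  · rintro ⟨j, r⟩ h
    simp only [Finset.mem_product, Finset.mem_range] at h
    obtain ⟨h1, h2⟩ := key j r h.2
    simp [h1, h2]
  · intro i _
    exact Nat.div_add_mod' i (q + 1)
  · intro p _
    rfl

/-- There are at most n / (q + 1) + 1 omitted indices of residue q, and at most q + 1 in the
incomplete block. -/
lemma card_filter_not_block_le (n q : ℕ) :
    ((Finset.range n).filter
      (fun i ↦ ¬(i % (q + 1) ≠ q ∧ i / (q + 1) < n / (q + 1)))).card ≤ n / (q + 1) + (q + 2) := by
  have h : (Finset.range n).filter (fun i ↦ ¬(i % (q + 1) ≠ q ∧ i / (q + 1) < n / (q + 1))) ⊆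
      (Finset.range (n / (q + 1) + 1)).image (fun j ↦ (q + 1) * j + q) ∪
        (Finset.range (q + 1)).image (fun r ↦ (q + 1) * (n / (q + 1)) + r) := by
    intro i hi
    simp only [Finset.mem_filter, Finset.mem_range, Finset.mem_union, Finset.mem_image] at hi ⊢
    have h1 := Nat.div_add_mod i (q + 1)
    have h2 := Nat.mod_lt i (show 0 < q + 1 by omega)
    have h3 : i / (q + 1) ≤ n / (q + 1) := Nat.div_le_div_right hi.1.le
    by_cases hq : i % (q + 1) = q
    · exact Or.inl ⟨i / (q + 1), by omega, by rw [hq] at h1; exact h1⟩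
    · refine Or.inr ⟨i % (q + 1), h2, ?_⟩
      have h4 : i / (q + 1) = n / (q + 1) := by
        by_contra h5
        exact hi.2 ⟨hq, by omega⟩
      rw [← h4]
      exact h1
  refine (Finset.card_le_card h).trans ((Finset.card_union_le _ _).trans ?_)
  have h1 := Finset.card_image_le (s := Finset.range (n / (q + 1) + 1))
    (f := fun j ↦ (q + 1) * j + q)
  have h2 := Finset.card_image_le (s := Finset.range (q + 1))
    (f := fun r ↦ (q + 1) * (n / (q + 1)) + r)
  simp only [Finset.card_range] at h1 h2
  omega

end Blocks

/-! ### Central limit theorem for one-dependent sums -/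

section OneDependentCLT

variable {Ω : Type*} [MeasurableSpace Ω] {P : Measure Ω} [IsProbabilityMeasure P]
  {X : ℕ → Ω → ℝ} {γ : Measure ℝ} {a b d : ℝ → ℝ}
  (hX : ∀ i, Measurable (X i)) (hind : iIndepFun X P) (hlaw : ∀ i, HasLaw (X i) γ P)
  (ha : Measurable a) (hb : Measurable b) (hd : Measurable d)
  (ha2 : MemLp a 2 γ) (hb2 : MemLp b 2 γ) (hd2 : MemLp d 2 γ)
  (hb0 : ∫ x, b x ∂γ = 0) (hd0 : ∫ x, d x ∂γ = 0)

include hX hind hlaw ha hb hd ha2 hb2 hd2 hb0 hd0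

lemma integral_sum_consecutive_pairTerm_sq (s : Finset ℕ) :
    ∫ ω, (∑ i ∈ s, pairTerm a b d X i (i + 1) ω) ^ 2 ∂P = s.card * pairVariance a b d γ :=
  integral_sum_pairTerm_sq hX hind hlaw ha hb hd ha2 hb2 hd2 hb0 hd0 s (fun i ↦ i)
    (fun i ↦ i + 1) (by simp) (fun k _ l _ hkl ↦ by omega)

omit [IsProbabilityMeasure P] hX hd hb0 hd0 in
lemma memLp_sum_consecutive_pairTerm (s : Finset ℕ) :
    MemLp (fun ω ↦ ∑ i ∈ s, pairTerm a b d X i (i + 1) ω) 2 P :=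
  memLp_finsetSum _ fun _ _ ↦ memLp_pairTerm hind hlaw ha hb ha2 hb2 hd2 (by omega)

/-- Distinct blocks use disjoint sets of variables, so the block sums are i.i.d., and orthogonality
inside a block gives each of them variance q times `pairVariance`. This is the classical central
limit theorem for them. -/
lemma tendstoInDistribution_blockSums (q : ℕ) :
    TendstoInDistribution
      (fun (k : ℕ) ω ↦ (√k)⁻¹ * ∑ j ∈ Finset.range k, ∑ r ∈ Finset.range q,
        pairTerm a b d X (j * (q + 1) + r) (j * (q + 1) + r + 1) ω)
      atTop (fun z : ℝ ↦ z) (fun _ ↦ P)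
      (gaussianReal 0 (q * pairVariance a b d γ).toNNReal) := by
  have hm := measurable_blockSum ha hb hd q
  have hV : ∀ j : ℕ, Measurable (fun ω (r : Fin (q + 1)) ↦ X (j * (q + 1) + r) ω) := fun j ↦ by
    fun_prop
  have hinj : Function.Injective (fun p : ℕ × Fin (q + 1) ↦ p.1 * (q + 1) + p.2) := by
    rintro ⟨j, r⟩ ⟨j', r'⟩ h
    have hr := r.2
    have hr' := r'.2
    simp only at h
    have h1 := congrArg (· / (q + 1)) h
    have h2 := congrArg (· % (q + 1)) h
    simp only [mul_comm _ (q + 1), Nat.mul_add_mod, Nat.mul_add_div (show 0 < q + 1 by omega),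
      Nat.div_eq_of_lt hr, Nat.div_eq_of_lt hr', Nat.mod_eq_of_lt hr, Nat.mod_eq_of_lt hr',
      add_zero] at h1 h2
    exact Prod.ext h1 (Fin.ext h2)
  have hI : iIndepFun (fun j ω ↦ blockSum a b d q (fun r ↦ X (j * (q + 1) + r) ω)) P :=
    ((hind.precomp hinj).curry fun _ ↦ hX _).comp (fun _ ↦ blockSum a b d q) fun _ ↦ hm
  have hD : ∀ j : ℕ, IdentDistrib
      (fun ω ↦ blockSum a b d q (fun r ↦ X (j * (q + 1) + r) ω))
      (fun ω ↦ blockSum a b d q (fun r ↦ X (0 * (q + 1) + r) ω)) P P := fun j ↦ by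
    have h0 : ∀ j : ℕ, iIndepFun (fun (r : Fin (q + 1)) ↦ X (j * (q + 1) + r)) P := fun j ↦
      hind.precomp (g := fun r : Fin (q + 1) ↦ j * (q + 1) + r) fun r r' h ↦
        Fin.ext (by simpa using h)
    exact (IdentDistrib.pi (fun r ↦ ⟨(hX _).aemeasurable, (hX _).aemeasurable,
      by rw [(hlaw _).map_eq, (hlaw _).map_eq]⟩) (h0 j) (h0 0)).comp hm
  have e0 : (fun ω ↦ blockSum a b d q (fun r ↦ X (0 * (q + 1) + r) ω)) =
      fun ω ↦ ∑ r ∈ Finset.range q, pairTerm a b d X r (r + 1) ω := by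
    funext ω
    rw [blockSum_eq_sum_pairTerm]
    simp
  have hL := memLp_sum_consecutive_pairTerm hind hlaw ha hb ha2 hb2 hd2 (Finset.range q)
  have hmean : ∫ ω, ∑ r ∈ Finset.range q, pairTerm a b d X r (r + 1) ω ∂P = 0 := by
    rw [integral_finsetSum _ fun i _ ↦ (memLp_pairTerm hind hlaw ha hb ha2 hb2 hd2
      (by omega)).integrable (by norm_num)]
    exact Finset.sum_eq_zero fun i _ ↦
      integral_pairTerm hind hlaw ha hb hd ha2 hb2 hd2 hb0 hd0 (by omega)
  have hvar : Var[fun ω ↦ ∑ r ∈ Finset.range q, pairTerm a b d X r (r + 1) ω; P] =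
      q * pairVariance a b d γ := by
    rw [variance_eq_sub hL, hmean]
    simp only [Pi.pow_apply]
    rw [integral_sum_consecutive_pairTerm_sq hX hind hlaw ha hb hd ha2 hb2 hd2 hb0 hd0]
    simp
  have h := tendstoInDistribution_inv_sqrt_mul_sum_sub (Y := fun z : ℝ ↦ z)
    (P' := gaussianReal 0 (q * pairVariance a b d γ).toNNReal)
    (X := fun j ω ↦ blockSum a b d q (fun r ↦ X (j * (q + 1) + r) ω)) (P := P)
    (by rw [e0, hvar]; exact HasLaw.id) (by rw [e0]; exact hL) hI hD
  rw [e0, hmean] at h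
  simp only [blockSum_eq_sum_pairTerm, mul_zero, sub_zero] at h
  exact h

/-- The normalization passes from the number of blocks to n by Slutsky's lemma. The limiting ratio
(q + 1)^{-1/2} appears as a rescaled argument of the characteristic function. -/
lemma tendsto_charFun_blockSums (q : ℕ) (t : ℝ) :
    Tendsto (fun n : ℕ ↦ charFun (P.map (fun ω ↦ (√n)⁻¹ * ∑ j ∈ Finset.range (n / (q + 1)),
        ∑ r ∈ Finset.range q,
          pairTerm a b d X (j * (q + 1) + r) (j * (q + 1) + r + 1) ω)) t) atTop
      (nhds (charFun (gaussianReal 0 (q * pairVariance a b d γ).toNNReal) ((√(q + 1))⁻¹ * t))) := by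
  have h := tendstoInDistribution_blockSums hX hind hlaw ha hb hd ha2 hb2 hd2 hb0 hd0 q
  have hdiv : Tendsto (fun n : ℕ ↦ n / (q + 1)) atTop atTop :=
    Nat.tendsto_div_const_atTop (by omega)
  have h1 : TendstoInDistribution
      (fun (n : ℕ) ω ↦ (√(n / (q + 1) : ℕ))⁻¹ * ∑ j ∈ Finset.range (n / (q + 1)),
        ∑ r ∈ Finset.range q, pairTerm a b d X (j * (q + 1) + r) (j * (q + 1) + r + 1) ω)
      atTop (fun z : ℝ ↦ z) (fun _ ↦ P)
      (gaussianReal 0 (q * pairVariance a b d γ).toNNReal) :=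
    ⟨fun n ↦ h.forall_aemeasurable _, h.aemeasurable_limit, h.tendsto.comp hdiv⟩
  have hc : Tendsto (fun n : ℕ ↦ √((n / (q + 1) : ℕ) : ℝ) / √n) atTop (nhds (√(q + 1))⁻¹) := by
    have h2 : Tendsto (fun n : ℕ ↦ ((n / (q + 1) : ℕ) : ℝ) / n) atTop (nhds ((q : ℝ) + 1)⁻¹) := by
      have h3 := (tendsto_nat_floor_mul_div_atTop (R := ℝ) (a := ((q : ℝ) + 1)⁻¹)
        (by positivity)).comp tendsto_natCast_atTop_atTop
      refine h3.congr fun n ↦ ?_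
      have : ⌊((q : ℝ) + 1)⁻¹ * n⌋₊ = n / (q + 1) := by
        rw [inv_mul_eq_div]
        have := Nat.floor_div_eq_div (K := ℝ) n (q + 1)
        push_cast at this
        exact this
      simp only [Function.comp_apply, this]
    have h4 := (Real.continuous_sqrt.tendsto _).comp h2
    rw [Real.sqrt_inv] at h4
    refine h4.congr fun n ↦ ?_
    simp only [Function.comp_apply]
    rw [Real.sqrt_div (by positivity)]
  have hcm : TendstoInMeasure P (fun (n : ℕ) (_ : Ω) ↦ √((n / (q + 1) : ℕ) : ℝ) / √n) atTop
      (fun _ ↦ (√((q : ℝ) + 1))⁻¹) :=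
    tendstoInMeasure_of_tendsto_ae (fun _ ↦ aestronglyMeasurable_const) (ae_of_all _ fun _ ↦ hc)
  have h5 := h1.continuous_comp_prodMk_of_tendstoInMeasure_const
    (g := fun p : ℝ × ℝ ↦ p.2 * p.1) (by fun_prop) hcm (fun _ ↦ aemeasurable_const)
  have h6 := ProbabilityMeasure.tendsto_iff_tendsto_charFun.1 h5.tendsto t
  simp only [ProbabilityMeasure.coe_mk] at h6
  rw [charFun_map_mul_comp aemeasurable_id', Measure.map_id'] at h6
  refine h6.congr' ?_
  filter_upwards [hdiv.eventually_gt_atTop 0] with n hn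
  congr 2
  funext ω
  have : √((n / (q + 1) : ℕ) : ℝ) ≠ 0 := Real.sqrt_ne_zero'.2 (by exact_mod_cast hn)
  rw [← mul_assoc]
  congr 1
  field_simp

/-- **Central limit theorem** for sums of `a (X i) * b (X (i + 1)) + d (X (i + 1))`, where the
`X i` are i.i.d. and `b`, `d` are centered. -/
theorem tendstoInDistribution_sum_pairTerm :
    TendstoInDistribution
      (fun (n : ℕ) ω ↦ (√n)⁻¹ * ∑ i ∈ Finset.range n, pairTerm a b d X i (i + 1) ω)
      atTop (fun z : ℝ ↦ z) (fun _ ↦ P)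
      (gaussianReal 0 (pairVariance a b d γ).toNNReal) := by
  have hv : 0 ≤ pairVariance a b d γ := by
    rw [← integral_pairTerm_sq hind hlaw ha hb hd ha2 hb2 hd2 zero_ne_one]
    positivity
  have hW := measurable_pairTerm hX ha hb hd
  have hdiff : ∀ q n : ℕ, ∀ ω,
      (√n)⁻¹ * ∑ i ∈ Finset.range n, pairTerm a b d X i (i + 1) ω -
        (√n)⁻¹ * ∑ j ∈ Finset.range (n / (q + 1)), ∑ r ∈ Finset.range q,
          pairTerm a b d X (j * (q + 1) + r) (j * (q + 1) + r + 1) ω =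
      (√n)⁻¹ * ∑ i ∈ (Finset.range n).filter
        (fun i ↦ ¬(i % (q + 1) ≠ q ∧ i / (q + 1) < n / (q + 1))),
          pairTerm a b d X i (i + 1) ω := by
    intro q n ω
    rw [sum_blocks_eq_sum_filter (fun i ↦ pairTerm a b d X i (i + 1) ω),
      ← Finset.sum_filter_add_sum_filter_not (Finset.range n)
        (fun i ↦ i % (q + 1) ≠ q ∧ i / (q + 1) < n / (q + 1))]
    ring
  have hL : ∀ q n : ℕ, MemLp (fun ω ↦ (√n)⁻¹ * ∑ i ∈ (Finset.range n).filter
        (fun i ↦ ¬(i % (q + 1) ≠ q ∧ i / (q + 1) < n / (q + 1))),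
          pairTerm a b d X i (i + 1) ω) 2 P := fun q n ↦
    (memLp_sum_consecutive_pairTerm hind hlaw ha hb ha2 hb2 hd2 _).const_mul _
  -- For n ≥ (q + 2)(q + 1) at most 2n / (q + 1) terms are omitted; being orthogonal, they have
  -- after division by √n a second moment of at most 2 / (q + 1) times `pairVariance`.
  refine tendstoInDistribution_of_approx (δ := fun q ↦ √(2 * pairVariance a b d γ * (1 / (q + 1))))
    (fun n ↦ by fun_prop) (fun q n ↦ by fun_prop) (fun q n ↦ ?_)
    (fun q t ↦ tendsto_charFun_blockSums hX hind hlaw ha hb hd ha2 hb2 hd2 hb0 hd0 q t) ?_ ?_ ?_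
  · simp_rw [hdiff]
    exact (hL q n).integrable (by norm_num)
  · intro t
    simp only [charFun_gaussianReal]
    refine (Complex.continuous_exp.tendsto _).comp ?_
    have h1 : Tendsto (fun q : ℕ ↦ (q : ℝ) / (q + 1)) atTop (nhds 1) :=
      tendsto_natCast_div_add_atTop 1
    have h2 : Tendsto (fun q : ℕ ↦ -(((q : ℝ) / (q + 1)) * pairVariance a b d γ * t ^ 2 / 2))
        atTop (nhds (-(1 * pairVariance a b d γ * t ^ 2 / 2))) :=
      (((h1.mul_const _).mul_const _).div_const _).neg
    have h3 := (Complex.continuous_ofReal.tendsto _).comp h2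
    convert h3 using 2 with q
    · have hs : √((q : ℝ) + 1) ^ 2 = q + 1 := Real.sq_sqrt (by positivity)
      have : (((q * pairVariance a b d γ).toNNReal : ℝ)) = q * pairVariance a b d γ :=
        Real.coe_toNNReal _ (by positivity)
      have e : ((√((q : ℝ) + 1))⁻¹ * t) ^ 2 = (q + 1 : ℝ)⁻¹ * t ^ 2 := by
        rw [mul_pow, inv_pow, hs]
      simp only [Function.comp_apply]
      rw [← Complex.ofReal_pow, e, this]
      push_cast
      field_simp
      ring
    · have : ((pairVariance a b d γ).toNNReal : ℝ) = pairVariance a b d γ :=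
        Real.coe_toNNReal _ hv
      rw [this]
      push_cast
      ring
  · have h1 := (tendsto_one_div_add_atTop_nhds_zero_nat (𝕜 := ℝ)).const_mul
      (2 * pairVariance a b d γ)
    have h2 := (Real.continuous_sqrt.tendsto _).comp h1
    simpa [Function.comp_def] using h2
  · intro q
    filter_upwards [eventually_ge_atTop ((q + 2) * (q + 1)), eventually_gt_atTop 0] with n hn hn0
    simp_rw [hdiff]
    refine (integral_abs_le_sqrt_integral_sq (hL q n)).trans (Real.sqrt_le_sqrt ?_)
    simp_rw [mul_pow]
    rw [integral_const_mul, integral_sum_consecutive_pairTerm_sq hX hind hlaw ha hb hd ha2 hb2 hd2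
      hb0 hd0, inv_pow, Real.sq_sqrt (by positivity)]
    have hc : (((Finset.range n).filter
        (fun i ↦ ¬(i % (q + 1) ≠ q ∧ i / (q + 1) < n / (q + 1)))).card : ℝ) ≤
        n / (q + 1) + (q + 2) := by
      have h1 : ((n / (q + 1) : ℕ) : ℝ) ≤ n / (q + 1) := by
        simpa using Nat.cast_div_le (α := ℝ) (m := n) (n := q + 1)
      have h2 : (((Finset.range n).filter (fun i ↦ ¬(i % (q + 1) ≠ q ∧
          i / (q + 1) < n / (q + 1)))).card : ℝ) ≤ ((n / (q + 1) : ℕ) : ℝ) + (q + 2) := by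
        exact_mod_cast card_filter_not_block_le n q
      linarith
    have h3 : (q + 2 : ℝ) ≤ n / (q + 1) := by
      rw [le_div_iff₀ (by positivity)]
      exact_mod_cast hn
    have hn' : (0 : ℝ) < n := by exact_mod_cast hn0
    calc (n : ℝ)⁻¹ * (_ * pairVariance a b d γ)
        ≤ (n : ℝ)⁻¹ * ((2 * (n / (q + 1))) * pairVariance a b d γ) := by
          gcongr
          linarith
      _ = 2 * pairVariance a b d γ * (1 / (q + 1)) := by
          field_simp

end OneDependentCLT

/-! ### Absolute Gaussian moments and the limiting variance -/

section GaussianMoments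

lemma integral_abs_pow_gaussianReal (k : ℕ) :
    ∫ x, |x| ^ k ∂(gaussianReal 0 1) =
      (1 / 2 : ℝ) ^ (-(k + 1 : ℝ) / 2) * Real.Gamma ((k + 1 : ℝ) / 2) / √(2 * Real.pi) := by
  rw [integral_gaussianReal_eq_integral_smul one_ne_zero]
  have e : ∀ x : ℝ, gaussianPDFReal 0 1 x • |x| ^ k =
      (fun r : ℝ ↦ (√(2 * Real.pi))⁻¹ * (r ^ (k : ℝ) * Real.exp (-(1 / 2) * r ^ (2 : ℝ)))) |x| := by
    intro x
    simp only [gaussianPDFReal, smul_eq_mul, Real.rpow_natCast, Real.rpow_two, sq_abs]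
    norm_num
    ring_nf
  rw [integral_congr_ae (ae_of_all _ e), integral_comp_abs (f := fun r : ℝ ↦ (√(2 * Real.pi))⁻¹ *
    (r ^ (k : ℝ) * Real.exp (-(1 / 2) * r ^ (2 : ℝ)))), integral_const_mul, integral_rpow_mul_exp_neg_mul_rpow (by norm_num)
    (by linarith [(k.cast_nonneg : (0 : ℝ) ≤ k)]) (by norm_num)]
  ring

/-- This is Γ(s + 1) = s Γ(s). It reduces the moments up to order four to those of orders 0 and 1.
-/
lemma integral_abs_pow_add_two_gaussianReal (k : ℕ) :
    ∫ x, |x| ^ (k + 2) ∂(gaussianReal 0 1) = (k + 1) * ∫ x, |x| ^ k ∂(gaussianReal 0 1) := by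
  rw [integral_abs_pow_gaussianReal, integral_abs_pow_gaussianReal]
  have h1 : (((k + 2 : ℕ) : ℝ) + 1) / 2 = (k + 1 : ℝ) / 2 + 1 := by push_cast; ring
  have h2 : -(((k + 2 : ℕ) : ℝ) + 1) / 2 = -(k + 1 : ℝ) / 2 - 1 := by push_cast; ring
  rw [h1, h2, Real.Gamma_add_one (by positivity), Real.rpow_sub_one (by norm_num)]
  ring

/-- The mean `√(2 / π)` of the absolute value of a standard normal variable. -/
noncomputable def gaussianAbsMean : ℝ := 2 / √(2 * Real.pi)

lemma gaussianAbsMean_sq : gaussianAbsMean ^ 2 = 2 / Real.pi := by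
  rw [gaussianAbsMean, div_pow, Real.sq_sqrt (by positivity)]
  field_simp

lemma integral_abs_gaussianReal : ∫ x, |x| ∂(gaussianReal 0 1) = gaussianAbsMean := by
  have h := integral_abs_pow_gaussianReal 1
  norm_num [Real.rpow_neg_one] at h
  rw [h, gaussianAbsMean, Real.sqrt_mul (by norm_num)]

lemma integral_abs_sq_gaussianReal : ∫ x, |x| ^ 2 ∂(gaussianReal 0 1) = 1 := by
  simpa using integral_abs_pow_add_two_gaussianReal 0

lemma integral_abs_pow_three_gaussianReal :
    ∫ x, |x| ^ 3 ∂(gaussianReal 0 1) = 2 * gaussianAbsMean := by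
  rw [integral_abs_pow_add_two_gaussianReal 1]
  simp only [pow_one, integral_abs_gaussianReal]
  norm_num

lemma integral_abs_pow_four_gaussianReal : ∫ x, |x| ^ 4 ∂(gaussianReal 0 1) = 3 := by
  rw [integral_abs_pow_add_two_gaussianReal 2, integral_abs_sq_gaussianReal]
  norm_num

lemma integrable_abs_pow_gaussianReal (k : ℕ) :
    Integrable (fun x : ℝ ↦ |x| ^ k) (gaussianReal 0 1) :=
  (memLp_id_gaussianReal k).integrable_norm_pow'

lemma memLp_abs_gaussianReal : MemLp (fun x : ℝ ↦ |x|) 2 (gaussianReal 0 1) :=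
  (memLp_two_iff_integrable_sq (by fun_prop)).2 (integrable_abs_pow_gaussianReal 2)

lemma memLp_id_two_gaussianReal : MemLp (fun x : ℝ ↦ x) 2 (gaussianReal 0 1) :=
  memLp_id_gaussianReal 2

lemma memLp_sq_gaussianReal : MemLp (fun x : ℝ ↦ x ^ 2) 2 (gaussianReal 0 1) := by
  refine (memLp_two_iff_integrable_sq (by fun_prop)).2 ?_
  refine (integrable_abs_pow_gaussianReal 4).congr (ae_of_all _ fun x ↦ ?_)
  simp only
  rw [← sq_abs x]
  ring

lemma integral_sq_gaussianReal : ∫ x, x ^ 2 ∂(gaussianReal 0 1) = 1 := by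
  simpa only [sq_abs] using integral_abs_sq_gaussianReal

lemma integral_odd_gaussianReal {f : ℝ → ℝ} (hf : Measurable f) (hodd : ∀ x, f (-x) = -f x) :
    ∫ x, f x ∂(gaussianReal 0 1) = 0 := by
  have h : (gaussianReal 0 1).map (fun x ↦ -x) = gaussianReal 0 1 := by
    rw [gaussianReal_map_neg, neg_zero]
  have h1 : ∫ x, f x ∂(gaussianReal 0 1) = -∫ x, f x ∂(gaussianReal 0 1) := by
    conv_lhs => rw [← h, integral_map (by fun_prop) hf.aestronglyMeasurable]
    simp_rw [hodd]
    rw [integral_neg]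
  linarith

lemma measurable_realSign : Measurable Real.sign := by
  unfold Real.sign
  exact Measurable.ite measurableSet_Iio measurable_const
    (Measurable.ite measurableSet_Ioi measurable_const measurable_const)

lemma abs_realSign_le_one (x : ℝ) : |x.sign| ≤ 1 := by
  rcases Real.sign_apply_eq x with h | h | h <;> simp [h]

lemma memLp_realSign_gaussianReal : MemLp Real.sign 2 (gaussianReal 0 1) :=
  MemLp.of_bound measurable_realSign.aestronglyMeasurable 1
    (ae_of_all _ fun x ↦ abs_realSign_le_one x)

lemma integral_realSign_gaussianReal : ∫ x, Real.sign x ∂(gaussianReal 0 1) = 0 :=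
  integral_odd_gaussianReal measurable_realSign fun _ ↦ Real.sign_neg

/-- The centered absolute value. -/
noncomputable def centeredAbs (x : ℝ) : ℝ := |x| - gaussianAbsMean

/-- The linear part in the martingale decomposition of the bivariation. -/
noncomputable def linearPart (x : ℝ) : ℝ :=
  2 * gaussianAbsMean * centeredAbs x - gaussianAbsMean ^ 2 * (x ^ 2 - 1)

lemma measurable_centeredAbs : Measurable centeredAbs := by
  unfold centeredAbs
  fun_prop

lemma measurable_linearPart : Measurable linearPart := by
  unfold linearPart centeredAbs
  fun_prop

lemma memLp_centeredAbs : MemLp centeredAbs 2 (gaussianReal 0 1) :=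
  memLp_abs_gaussianReal.sub (memLp_const _)

lemma memLp_linearPart : MemLp linearPart 2 (gaussianReal 0 1) :=
  (memLp_centeredAbs.const_mul _).sub ((memLp_sq_gaussianReal.sub (memLp_const _)).const_mul _)

lemma integral_centeredAbs : ∫ x, centeredAbs x ∂(gaussianReal 0 1) = 0 := by
  unfold centeredAbs
  rw [integral_sub (memLp_abs_gaussianReal.integrable (by norm_num)) (integrable_const _),
    integral_abs_gaussianReal]
  simp

lemma integral_sq_sub_one : ∫ x, (x ^ 2 - 1) ∂(gaussianReal 0 1) = 0 := by
  rw [integral_sub (memLp_sq_gaussianReal.integrable (by norm_num)) (integrable_const _),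
    integral_sq_gaussianReal]
  simp

lemma integral_linearPart : ∫ x, linearPart x ∂(gaussianReal 0 1) = 0 := by
  unfold linearPart
  have h1 := (memLp_centeredAbs.integrable (by norm_num)).const_mul (2 * gaussianAbsMean)
  have h2 : Integrable (fun x ↦ gaussianAbsMean ^ 2 * (x ^ 2 - 1)) (gaussianReal 0 1) :=
    ((memLp_sq_gaussianReal.integrable (by norm_num)).sub (integrable_const _)).const_mul _
  rw [integral_sub h1 h2, integral_const_mul, integral_const_mul, integral_centeredAbs,
    integral_sq_sub_one]
  simp

lemma integral_quartic_abs_gaussianReal (c₀ c₁ c₂ c₃ c₄ : ℝ) :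
    ∫ x, (c₀ + c₁ * |x| + c₂ * |x| ^ 2 + c₃ * |x| ^ 3 + c₄ * |x| ^ 4) ∂(gaussianReal 0 1) =
      c₀ + c₁ * gaussianAbsMean + c₂ + c₃ * (2 * gaussianAbsMean) + c₄ * 3 := by
  have h0 : Integrable (fun _ : ℝ ↦ c₀) (gaussianReal 0 1) := integrable_const _
  have h1 : Integrable (fun x : ℝ ↦ c₁ * |x|) (gaussianReal 0 1) :=
    (memLp_abs_gaussianReal.integrable (by norm_num)).const_mul _
  have h2 := (integrable_abs_pow_gaussianReal 2).const_mul c₂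
  have h3 := (integrable_abs_pow_gaussianReal 3).const_mul c₃
  have h4 := (integrable_abs_pow_gaussianReal 4).const_mul c₄
  rw [integral_add (by fun_prop) h4, integral_add (by fun_prop) h3, integral_add (by fun_prop) h2,
    integral_add h0 h1]
  simp only [integral_const_mul, integral_abs_gaussianReal, integral_abs_sq_gaussianReal,
    integral_abs_pow_three_gaussianReal, integral_abs_pow_four_gaussianReal]
  simp

/-- The cross term vanishes because `centeredAbs` has mean zero. With s = κ² = 2/π the rest is (1 -
s)² + 4s - 6s² = 1 + 2s - 5s². -/
lemma pairVariance_centeredAbs :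
    pairVariance centeredAbs centeredAbs linearPart (gaussianReal 0 1) =
      1 + 4 / Real.pi - 20 / Real.pi ^ 2 := by
  have h1 : ∫ x, centeredAbs x ^ 2 ∂(gaussianReal 0 1) = 1 - gaussianAbsMean ^ 2 := by
    have e : ∀ x, centeredAbs x ^ 2 = gaussianAbsMean ^ 2 + -2 * gaussianAbsMean * |x| +
        1 * |x| ^ 2 + 0 * |x| ^ 3 + 0 * |x| ^ 4 := fun x ↦ by
      unfold centeredAbs
      ring
    simp_rw [e]
    rw [integral_quartic_abs_gaussianReal]
    ring
  have h2 : ∫ x, linearPart x ^ 2 ∂(gaussianReal 0 1) =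
      4 * gaussianAbsMean ^ 2 - 6 * gaussianAbsMean ^ 4 := by
    have e : ∀ x, linearPart x ^ 2 = gaussianAbsMean ^ 4 + -4 * gaussianAbsMean ^ 3 * |x| +
        (4 * gaussianAbsMean ^ 2 + 2 * gaussianAbsMean ^ 4) * |x| ^ 2 +
        -4 * gaussianAbsMean ^ 3 * |x| ^ 3 + gaussianAbsMean ^ 4 * |x| ^ 4 := fun x ↦ by
      unfold linearPart centeredAbs
      rw [← sq_abs x]
      ring
    simp_rw [e]
    rw [integral_quartic_abs_gaussianReal]
    ring
  have h3 : gaussianAbsMean ^ 4 = (2 / Real.pi) ^ 2 := by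
    rw [← gaussianAbsMean_sq]
    ring
  rw [pairVariance, integral_centeredAbs, h1, h2, h3, gaussianAbsMean_sq]
  ring

end GaussianMoments

/-! ### Convergence in measure -/

section InMeasure

variable {Ω : Type*} [MeasurableSpace Ω] {P : Measure Ω} [IsProbabilityMeasure P]

omit [IsProbabilityMeasure P] in
lemma measureReal_le_integral_div {U : Ω → ℝ} (hU : ∀ ω, 0 ≤ U ω) (hi : Integrable U P) {ε : ℝ}
    (hε : 0 < ε) : P.real {ω | ε ≤ U ω} ≤ (∫ ω, U ω ∂P) / ε := by
  rw [le_div_iff₀ hε, mul_comm]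
  exact mul_meas_ge_le_integral_of_nonneg (ae_of_all _ hU) hi ε

lemma tendstoInMeasure_zero_of_abs_le {D H : ℕ → Ω → ℝ} (hDH : ∀ᶠ n in atTop, ∀ ω, |D n ω| ≤ H n ω)
    (hi : ∀ n, Integrable (H n) P) {h : ℕ → ℝ} (hh : ∀ᶠ n in atTop, ∫ ω, H n ω ∂P ≤ h n)
    (hh0 : Tendsto h atTop (nhds 0)) : TendstoInMeasure P D atTop 0 := by
  refine tendstoInMeasure_iff_measureReal_norm.2 fun ε hε ↦ ?_
  refine squeeze_zero' (Eventually.of_forall fun _ ↦ measureReal_nonneg) ?_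
    (by simpa using hh0.div_const ε)
  filter_upwards [hDH, hh] with n h1 h2
  calc P.real {ω | ε ≤ ‖D n ω - (0 : Ω → ℝ) ω‖} ≤ P.real {ω | ε ≤ H n ω} :=
        measureReal_mono fun ω hω ↦ by
          simp only [Set.mem_ofPred_eq, Pi.zero_apply, sub_zero, Real.norm_eq_abs] at hω
          exact hω.trans (h1 ω)
    _ ≤ (∫ ω, H n ω ∂P) / ε :=
        measureReal_le_integral_div (fun ω ↦ (abs_nonneg _).trans (h1 ω)) (hi n) hε
    _ ≤ h n / ε := by gcongr

/-- A sequence bounded in mean times a sequence tending to `0` in mean tends to `0` in measure. -/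
lemma tendstoInMeasure_zero_of_abs_le_mul {D U H : ℕ → Ω → ℝ}
    (hD : ∀ᶠ n in atTop, ∀ ω, |D n ω| ≤ U n ω * H n ω) (hU : ∀ n ω, 0 ≤ U n ω)
    (hH : ∀ n ω, 0 ≤ H n ω) (hUi : ∀ n, Integrable (U n) P) (hHi : ∀ n, Integrable (H n) P)
    {C : ℝ} {h : ℕ → ℝ} (hUC : ∀ n, ∫ ω, U n ω ∂P ≤ C)
    (hh : ∀ᶠ n in atTop, ∫ ω, H n ω ∂P ≤ h n)
    (hh0 : Tendsto h atTop (nhds 0)) : TendstoInMeasure P D atTop 0 := by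
  have hC : 0 ≤ C := (integral_nonneg (hU 0)).trans (hUC 0)
  refine tendstoInMeasure_iff_measureReal_norm.2 fun ε hε ↦ ?_
  rw [Metric.tendsto_nhds]
  intro η hη
  -- By Markov's inequality U exceeds K with probability at most η/2. Where U < K, a product of at
  -- least ε forces H ≥ ε/K, which is eventually improbable.
  obtain ⟨K, hK, hCK⟩ : ∃ K : ℝ, 0 < K ∧ C / K ≤ η / 2 := by
    refine ⟨2 * (C + 1) / η, by positivity, ?_⟩
    rw [div_le_iff₀ (by positivity)]
    field_simp
    linarith
  have h1 : Tendsto (fun n ↦ h n / (ε / K)) atTop (nhds 0) := by simpa using hh0.div_const (ε / K)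
  filter_upwards [hD, hh, h1.eventually_lt_const (show 0 < η / 2 by positivity)] with n h2 h3 h4
  rw [dist_zero_right, Real.norm_of_nonneg measureReal_nonneg]
  calc P.real {ω | ε ≤ ‖D n ω - (0 : Ω → ℝ) ω‖}
      ≤ P.real ({ω | K ≤ U n ω} ∪ {ω | ε / K ≤ H n ω}) :=
        measureReal_mono fun ω hω ↦ by
          simp only [Set.mem_ofPred_eq, Pi.zero_apply, sub_zero, Real.norm_eq_abs,
            Set.mem_union] at hω ⊢
          by_contra! hlt
          have h6 : U n ω * H n ω < ε := by
            calc U n ω * H n ω ≤ K * H n ω := mul_le_mul_of_nonneg_right hlt.1.le (hH n ω)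
              _ < K * (ε / K) := mul_lt_mul_of_pos_left hlt.2 hK
              _ = ε := by field_simp
          linarith [h2 ω]
    _ ≤ P.real {ω | K ≤ U n ω} + P.real {ω | ε / K ≤ H n ω} := measureReal_union_le _ _
    _ ≤ (∫ ω, U n ω ∂P) / K + (∫ ω, H n ω ∂P) / (ε / K) :=
        add_le_add (measureReal_le_integral_div (hU n) (hUi n) hK)
          (measureReal_le_integral_div (hH n) (hHi n) (by positivity))
    _ ≤ C / K + h n / (ε / K) := by
        gcongr
        exact hUC n
    _ < η := by linarith

/-- Convergence in measure means that every subsequence has an almost everywhere convergent further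
subsequence, so a pathwise implication along subsequences transfers. No global continuity is needed,
which suits the reciprocal and quotients whose denominator may vanish. -/
lemma tendstoInMeasure_of_forall_subseq {F G : ℕ → Ω → ℝ} {c e : ℝ}
    (hF : TendstoInMeasure P F atTop (fun _ ↦ c)) (hG : ∀ n, AEStronglyMeasurable (G n) P)
    (h : ∀ (ω : Ω) (ns : ℕ → ℕ), Tendsto ns atTop atTop →
      Tendsto (fun k ↦ F (ns k) ω) atTop (nhds c) → Tendsto (fun k ↦ G (ns k) ω) atTop (nhds e)) :
    TendstoInMeasure P G atTop (fun _ ↦ e) := by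
  rw [exists_seq_tendstoInMeasure_atTop_iff hG]
  intro ns hns
  obtain ⟨ms, hms, hae⟩ := (hF.comp hns.tendsto_atTop).exists_seq_tendsto_ae
  refine ⟨ms, hms, hae.mono fun ω hω ↦ ?_⟩
  exact h ω (fun k ↦ ns (ms k)) (hns.tendsto_atTop.comp hms.tendsto_atTop) hω

end InMeasure

/-! ### Deterministic estimates for centering and the martingale decomposition -/

section Pathwise

/-- The sum `∑ |x i| |x (i + 1)|` over the first `n` terms of a sequence. -/
def bivariationSum (n : ℕ) (x : ℕ → ℝ) : ℝ := ∑ i ∈ Finset.range (n - 1), |x i| * |x (i + 1)|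

/-- The sum of squares of the first `n` terms of a sequence. -/
def squareSum (n : ℕ) (x : ℕ → ℝ) : ℝ := ∑ i ∈ Finset.range n, x i ^ 2

/-- The mean of the first `n` terms of a sequence. -/
noncomputable def sampleMean (n : ℕ) (x : ℕ → ℝ) : ℝ := (∑ i ∈ Finset.range n, x i) / n

/-- If |m| < |x| the translation does not cross the kink and the expansion is exact. Otherwise the
error is at most 2|m|, and either |x| ≤ δ or |m| ≥ |x| > δ, in which case 2|m| ≤ 2|m|²/δ. -/
lemma abs_sub_first_order_le (x m : ℝ) {δ : ℝ} (hδ : 0 < δ) :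
    |(|x - m| - |x| + m * x.sign)| ≤
      2 * |m| * (if |x| ≤ δ then 1 else 0) + 2 * |m| / δ * |m| := by
  have hpos : 0 ≤ 2 * |m| / δ * |m| := by positivity
  rcases lt_or_ge |m| |x| with h | h
  · have h0 : |x - m| - |x| + m * x.sign = 0 := by
      rcases lt_trichotomy x 0 with hx | hx | hx
      · rw [abs_of_neg hx] at h ⊢
        rw [Real.sign_of_neg hx, abs_of_neg (by linarith [neg_abs_le m])]
        ring
      · subst hx
        simp only [abs_zero] at h
        linarith [abs_nonneg m]
      · rw [abs_of_pos hx] at h ⊢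
        rw [Real.sign_of_pos hx, abs_of_pos (by linarith [le_abs_self m])]
        ring
    rw [h0, abs_zero]
    split_ifs <;> positivity
  · have h2 : |(|x - m| - |x| + m * x.sign)| ≤ 2 * |m| := by
      have h3 : |(|x - m| - |x|)| ≤ |m| := by
        have := abs_abs_sub_abs_le_abs_sub (x - m) x
        simpa using this
      have h4 : |m * x.sign| ≤ |m| := by
        rw [abs_mul]
        exact mul_le_of_le_one_right (abs_nonneg _) (abs_realSign_le_one x)
      linarith [abs_add_le (|x - m| - |x|) (m * x.sign)]
    split_ifs with hx
    · linarith
    · rw [mul_zero, zero_add]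
      refine h2.trans ?_
      rw [div_mul_eq_mul_div, le_div_iff₀ hδ]
      exact mul_le_mul_of_nonneg_left (by linarith) (by positivity)

/-- The increment of `|x| |y|` under a common translation, up to its first order term. -/
lemma abs_mul_abs_sub_first_order_le (x y m : ℝ) {δ : ℝ} (hδ : 0 < δ) :
    |(|x - m| * |y - m| - |x| * |y| + m * (|x| * y.sign + |y| * x.sign))| ≤
      |m| * (2 * (|x| * (if |y| ≤ δ then 1 else 0)) + 2 * (|y| * (if |x| ≤ δ then 1 else 0)) +
        2 / δ * (|m| * |x| + |m| * |y|) + |m|) := by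
  have hx := abs_sub_first_order_le x m hδ
  have hy := abs_sub_first_order_le y m hδ
  have h1 : |(|x - m| - |x|)| ≤ |m| := by simpa using abs_abs_sub_abs_le_abs_sub (x - m) x
  have h2 : |(|y - m| - |y|)| ≤ |m| := by simpa using abs_abs_sub_abs_le_abs_sub (y - m) y
  have e : |x - m| * |y - m| - |x| * |y| + m * (|x| * y.sign + |y| * x.sign) =
      |x| * (|y - m| - |y| + m * y.sign) + |y| * (|x - m| - |x| + m * x.sign) +
        (|x - m| - |x|) * (|y - m| - |y|) := by ring
  rw [e]
  refine (abs_add_three _ _ _).trans ?_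
  rw [abs_mul, abs_mul, abs_mul, abs_abs, abs_abs]
  have h3 := mul_le_mul_of_nonneg_left hy (abs_nonneg x)
  have h4 := mul_le_mul_of_nonneg_left hx (abs_nonneg y)
  have h5 := mul_le_mul h1 h2 (abs_nonneg _) (abs_nonneg m)
  calc _ ≤ |x| * (2 * |m| * (if |y| ≤ δ then 1 else 0) + 2 * |m| / δ * |m|) +
        |y| * (2 * |m| * (if |x| ≤ δ then 1 else 0) + 2 * |m| / δ * |m|) + |m| * |m| := by linarith
    _ = _ := by ring

lemma squareSum_sub_sampleMean {n : ℕ} (hn : 0 < n) (x : ℕ → ℝ) :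
    squareSum n (fun i ↦ x i - sampleMean n x) = squareSum n x - n * sampleMean n x ^ 2 := by
  have hn' : (n : ℝ) ≠ 0 := by exact_mod_cast hn.ne'
  have h : ∑ i ∈ Finset.range n, x i = n * sampleMean n x := by
    rw [sampleMean]
    field_simp
  have e : ∀ i, (x i - sampleMean n x) ^ 2 =
      x i ^ 2 - 2 * sampleMean n x * x i + sampleMean n x ^ 2 := fun i ↦ by ring
  simp only [squareSum, e]
  rw [Finset.sum_add_distrib, Finset.sum_sub_distrib, ← Finset.mul_sum, h]
  simp
  ring

/-- The coefficient of the sample mean in the bound for the effect of centering. -/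
noncomputable def centeringError (n : ℕ) (δ : ℝ) (x : ℕ → ℝ) : ℝ :=
  (|∑ i ∈ Finset.range (n - 1), |x i| * (x (i + 1)).sign| +
    |∑ i ∈ Finset.range (n - 1), |x (i + 1)| * (x i).sign| +
    ∑ i ∈ Finset.range (n - 1), (2 * (|x i| * (if |x (i + 1)| ≤ δ then 1 else 0)) +
      2 * (|x (i + 1)| * (if |x i| ≤ δ then 1 else 0)) +
      2 / δ * (|sampleMean n x| * |x i| + |sampleMean n x| * |x (i + 1)|) + |sampleMean n x|)) / n

lemma centeringError_nonneg (n : ℕ) {δ : ℝ} (hδ : 0 ≤ δ) (x : ℕ → ℝ) :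
    0 ≤ centeringError n δ x := by
  unfold centeringError
  refine div_nonneg (add_nonneg (by positivity) (Finset.sum_nonneg fun i _ ↦ ?_)) (by positivity)
  positivity

/-- The bound isolates √n times the sample mean, bounded in mean, from a factor that will tend to
zero in mean. The sign sums stay inside one absolute value each because their cancellation is
needed. -/
lemma abs_bivariationSum_sub_le {n : ℕ} {δ : ℝ} (hδ : 0 < δ) (x : ℕ → ℝ) :
    |(√n)⁻¹ * (bivariationSum n (fun i ↦ x i - sampleMean n x) - bivariationSum n x)| ≤
      (√n * |sampleMean n x|) * centeringError n δ x := by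
  set m := sampleMean n x with hm
  have e : bivariationSum n (fun i ↦ x i - m) - bivariationSum n x =
      ∑ i ∈ Finset.range (n - 1), (|x i - m| * |x (i + 1) - m| - |x i| * |x (i + 1)| +
        m * (|x i| * (x (i + 1)).sign + |x (i + 1)| * (x i).sign)) -
      m * (∑ i ∈ Finset.range (n - 1), |x i| * (x (i + 1)).sign) -
      m * (∑ i ∈ Finset.range (n - 1), |x (i + 1)| * (x i).sign) := by
    simp only [bivariationSum, Finset.mul_sum, ← Finset.sum_sub_distrib]
    exact Finset.sum_congr rfl fun i _ ↦ by ring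
  have h1 := (Finset.abs_sum_le_sum_abs _ _).trans (Finset.sum_le_sum fun i
    (_ : i ∈ Finset.range (n - 1)) ↦ abs_mul_abs_sub_first_order_le (x i) (x (i + 1)) m hδ)
  rw [← Finset.mul_sum] at h1
  have h2 : |bivariationSum n (fun i ↦ x i - m) - bivariationSum n x| ≤
      |m| * (n * centeringError n δ x) := by
    rcases Nat.eq_zero_or_pos n with rfl | hn
    · simp [bivariationSum]
    have hn' : (n : ℝ) ≠ 0 := by exact_mod_cast hn.ne'
    rw [centeringError, mul_div_cancel₀ _ hn', e, ← hm, mul_add, mul_add, ← abs_mul, ← abs_mul]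
    refine (abs_sub _ _).trans ?_
    have h3 := abs_sub (∑ i ∈ Finset.range (n - 1), (|x i - m| * |x (i + 1) - m| -
      |x i| * |x (i + 1)| + m * (|x i| * (x (i + 1)).sign + |x (i + 1)| * (x i).sign)))
      (m * (∑ i ∈ Finset.range (n - 1), |x i| * (x (i + 1)).sign))
    linarith
  rw [abs_mul, abs_of_nonneg (by positivity)]
  refine (mul_le_mul_of_nonneg_left h2 (by positivity)).trans (le_of_eq ?_)
  have h4 : (√(n : ℝ))⁻¹ * n = √n := by
    rw [inv_mul_eq_div, Real.div_sqrt]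
  calc _ = ((√(n : ℝ))⁻¹ * n) * |m| * centeringError n δ x := by ring
    _ = _ := by rw [h4]

/-- Expand |x i| |x (i + 1)| around the mean κ of each factor, and move the linear term in x i to
the index i + 1; the linear terms double and boundary terms remain. The sum runs over all of `range
n` to match the limit theorem, so its last term, which involves the foreign entry x n, is
subtracted. -/
lemma bivariationSum_sub_squareSum_eq {n : ℕ} (hn : 0 < n) (x : ℕ → ℝ) :
    bivariationSum n x - gaussianAbsMean ^ 2 * squareSum n x =
      ∑ i ∈ Finset.range n, (centeredAbs (x i) * centeredAbs (x (i + 1)) + linearPart (x (i + 1))) -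
      (centeredAbs (x (n - 1)) * centeredAbs (x n) + linearPart (x n)) -
      gaussianAbsMean * |x (n - 1)| + gaussianAbsMean * |x 0| - gaussianAbsMean ^ 2 * x 0 ^ 2 := by
  obtain ⟨k, rfl⟩ : ∃ k, n = k + 1 := ⟨n - 1, by omega⟩
  rw [Finset.sum_range_succ]
  simp only [bivariationSum, squareSum, Nat.add_sub_cancel, linearPart, centeredAbs]
  induction k with
  | zero => simp
  | succ k ih =>
    have h := ih (by omega)
    simp only [Finset.sum_range_succ] at h ⊢
    linarith

end Pathwise

/-! ### Mean bounds for Gaussian sequences -/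

section GaussianSequence

variable {Ω : Type*} [MeasurableSpace Ω] {P : Measure Ω} [IsProbabilityMeasure P]
  {X : ℕ → Ω → ℝ} (hX : ∀ i, Measurable (X i)) (hind : iIndepFun X P)
  (hlaw : ∀ i, HasLaw (X i) (gaussianReal 0 1) P)

lemma integral_abs_sum_le {ι : Type*} {s : Finset ι} {Z : ι → Ω → ℝ} {V : ℝ}
    (hZ : ∀ i ∈ s, MemLp (Z i) 2 P) (h : ∫ ω, (∑ i ∈ s, Z i ω) ^ 2 ∂P = s.card * V) {n : ℕ}
    (hs : s.card ≤ n) (hV : 0 ≤ V) : (∫ ω, |∑ i ∈ s, Z i ω| ∂P) / n ≤ √V * (√n)⁻¹ := by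
  have h1 := integral_abs_le_sqrt_integral_sq (memLp_finsetSum s hZ)
  rw [h] at h1
  have h2 : √(s.card * V) ≤ √n * √V := by
    rw [← Real.sqrt_mul (by positivity)]
    gcongr
  calc _ ≤ (√n * √V) / n := by gcongr; exact h1.trans h2
    _ = √V * (√n / n) := by ring
    _ = _ := by rw [Real.sqrt_div_self', one_div]

include hX hind hlaw in
lemma integral_sum_comp_sq {d : ℝ → ℝ} (hd : Measurable d) (hd2 : MemLp d 2 (gaussianReal 0 1))
    (hd0 : ∫ x, d x ∂(gaussianReal 0 1) = 0) (n : ℕ) :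
    ∫ ω, (∑ i ∈ Finset.range n, d (X i ω)) ^ 2 ∂P =
      (Finset.range n).card * ∫ x, d x ^ 2 ∂(gaussianReal 0 1) := by
  -- With a = b = 0 only `d` at the second index survives; the first index i + 1 is a dummy, chosen
  -- to differ from i.
  have h := integral_sum_pairTerm_sq (a := fun _ ↦ 0) (b := fun _ ↦ 0) (d := d) hX hind hlaw
    measurable_const measurable_const hd (memLp_const _) (memLp_const _) hd2 (by simp) hd0
    (Finset.range n) (fun i ↦ i + 1) (fun i ↦ i) (by simp) (fun k _ l _ hkl ↦ by omega)
  simpa [pairTerm, pairVariance] using h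

omit [IsProbabilityMeasure P] in
include hlaw in
lemma memLp_gaussian_seq (i : ℕ) : MemLp (X i) 2 P :=
  memLp_comp_of_hasLaw hlaw memLp_id_two_gaussianReal i

omit [IsProbabilityMeasure P] in
include hlaw in
lemma memLp_sampleMean (n : ℕ) : MemLp (fun ω ↦ sampleMean n (X · ω)) 2 P := by
  have h := (memLp_finsetSum (Finset.range n) fun i _ ↦ memLp_gaussian_seq hlaw i).const_mul
    ((n : ℝ)⁻¹)
  refine (memLp_congr_ae (ae_of_all _ fun ω ↦ ?_)).1 h
  simp only [sampleMean]
  ring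

include hX hind hlaw in
lemma integral_sampleMean_sq (n : ℕ) : ∫ ω, sampleMean n (X · ω) ^ 2 ∂P = (n : ℝ)⁻¹ := by
  have h := integral_sum_comp_sq hX hind hlaw measurable_id' memLp_id_two_gaussianReal
    integral_id_gaussianReal n
  rw [integral_sq_gaussianReal, mul_one, Finset.card_range] at h
  simp only [sampleMean, div_pow]
  rw [integral_div, h]
  rcases eq_or_ne (n : ℝ) 0 with h0 | h0
  · simp [h0]
  · field_simp

include hX hind hlaw in
lemma integral_abs_sampleMean_le (n : ℕ) : ∫ ω, |sampleMean n (X · ω)| ∂P ≤ (√n)⁻¹ := by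
  refine (integral_abs_le_sqrt_integral_sq (memLp_sampleMean hlaw n)).trans (le_of_eq ?_)
  rw [integral_sampleMean_sq hX hind hlaw, Real.sqrt_inv]

include hX hind hlaw in
-- The sample mean depends on X i, so the product is split by 2uv ≤ √n u² + v²/√n. The weight
-- balances the second moments 1/n and 1.
lemma integral_abs_sampleMean_mul_abs_le {n : ℕ} (hn : 0 < n) (i : ℕ) :
    ∫ ω, |sampleMean n (X · ω)| * |X i ω| ∂P ≤ (√n)⁻¹ := by
  have hm := memLp_sampleMean (P := P) hlaw n
  have hx := memLp_gaussian_seq hlaw i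
  have hs : 0 < √(n : ℝ) := Real.sqrt_pos.2 (by exact_mod_cast hn)
  have h : ∀ ω, |sampleMean n (X · ω)| * |X i ω| ≤
      √n / 2 * sampleMean n (X · ω) ^ 2 + (√n)⁻¹ / 2 * X i ω ^ 2 := fun ω ↦ by
    rw [← sq_abs (sampleMean n _), ← sq_abs (X i ω)]
    have h1 := sq_nonneg (√n * |sampleMean n (X · ω)| - |X i ω|)
    have e : √n / 2 * |sampleMean n (X · ω)| ^ 2 + (√n)⁻¹ / 2 * |X i ω| ^ 2 -
        |sampleMean n (X · ω)| * |X i ω| =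
        (√n)⁻¹ / 2 * (√n * |sampleMean n (X · ω)| - |X i ω|) ^ 2 := by
      field_simp
      ring
    have h2 : 0 ≤ (√(n : ℝ))⁻¹ / 2 * (√n * |sampleMean n (X · ω)| - |X i ω|) ^ 2 := by positivity
    linarith
  refine (integral_mono (hm.abs.integrable_mul hx.abs)
    ((hm.integrable_sq.const_mul _).add (hx.integrable_sq.const_mul _)) h).trans (le_of_eq ?_)
  simp only [Pi.add_apply]
  rw [integral_add (hm.integrable_sq.const_mul _) (hx.integrable_sq.const_mul _),
    integral_const_mul, integral_const_mul, integral_sampleMean_sq hX hind hlaw,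
    integral_comp_of_hasLaw (f := fun x ↦ x ^ 2) hlaw (by fun_prop), integral_sq_gaussianReal]
  have e : √(n : ℝ) * (n : ℝ)⁻¹ = (√n)⁻¹ := by
    rw [← div_eq_mul_inv, Real.sqrt_div_self', one_div]
  linear_combination e / 2

/-- The standard Gaussian mass of `[-δ, δ]`. -/
noncomputable def gaussianSmallBall (δ : ℝ) : ℝ :=
  ∫ x, (if |x| ≤ δ then 1 else 0) ∂(gaussianReal 0 1)

lemma measurable_indicator_abs_le (δ : ℝ) :
    Measurable (fun x : ℝ ↦ if |x| ≤ δ then (1 : ℝ) else 0) :=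
  Measurable.ite (measurableSet_le (by fun_prop) measurable_const) measurable_const measurable_const

lemma memLp_indicator_abs_le (δ : ℝ) :
    MemLp (fun x : ℝ ↦ if |x| ≤ δ then (1 : ℝ) else 0) 2 (gaussianReal 0 1) :=
  MemLp.of_bound (measurable_indicator_abs_le δ).aestronglyMeasurable 1
    (ae_of_all _ fun x ↦ by split_ifs <;> simp)

/-- Dominated convergence, the Gaussian law having no atom at 0. -/
lemma tendsto_gaussianSmallBall {δ : ℕ → ℝ} (hδ : Tendsto δ atTop (nhds 0)) :
    Tendsto (fun n ↦ gaussianSmallBall (δ n)) atTop (nhds 0) := by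
  have := nullSingletonClass_gaussianReal (μ := 0) (v := 1) one_ne_zero
  have h := tendsto_integral_of_dominated_convergence (μ := gaussianReal 0 1)
    (F := fun n x ↦ if |x| ≤ δ n then (1 : ℝ) else 0) (f := fun _ ↦ 0) (fun _ ↦ 1)
    (fun n ↦ (measurable_indicator_abs_le _).aestronglyMeasurable) (integrable_const _)
    (fun n ↦ ae_of_all _ fun x ↦ by split_ifs <;> simp) ?_
  · simpa [gaussianSmallBall] using h
  · filter_upwards [(Set.countable_singleton (0 : ℝ)).ae_notMem (gaussianReal 0 1)] with x hx
    refine tendsto_const_nhds.congr' ?_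
    filter_upwards [hδ.eventually_lt_const (abs_pos.2 (by simpa using hx))] with n hn
    rw [if_neg (by linarith)]

omit [IsProbabilityMeasure P] in
include hind hlaw in
lemma integral_abs_mul_indicator {i j : ℕ} (hij : i ≠ j) (δ : ℝ) :
    Integrable (fun ω ↦ |X i ω| * (if |X j ω| ≤ δ then 1 else 0)) P ∧
    ∫ ω, |X i ω| * (if |X j ω| ≤ δ then 1 else 0) ∂P = gaussianAbsMean * gaussianSmallBall δ := by
  have h1 := memLp_comp_of_hasLaw hlaw memLp_abs_gaussianReal i
  have h2 := memLp_comp_of_hasLaw hlaw (memLp_indicator_abs_le δ) j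
  have hI : IndepFun (fun ω ↦ |X i ω|) (fun ω ↦ if |X j ω| ≤ δ then (1 : ℝ) else 0) P :=
    (hind.indepFun hij).comp (φ := fun x ↦ |x|) (ψ := fun x : ℝ ↦ if |x| ≤ δ then (1 : ℝ) else 0)
      (by fun_prop) (measurable_indicator_abs_le δ)
  refine ⟨h1.integrable_mul h2, ?_⟩
  rw [hI.integral_fun_mul_eq_mul_integral h1.1 h2.1,
    integral_comp_of_hasLaw (f := fun x ↦ |x|) hlaw (by fun_prop), integral_abs_gaussianReal,
    integral_comp_of_hasLaw (f := fun x ↦ if |x| ≤ δ then (1 : ℝ) else 0) hlaw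
      (measurable_indicator_abs_le δ)]
  rfl

include hind hlaw in
lemma integrable_centeringError_summand (n i : ℕ) (δ : ℝ) :
    Integrable (fun ω ↦ 2 * (|X i ω| * (if |X (i + 1) ω| ≤ δ then 1 else 0)) +
      2 * (|X (i + 1) ω| * (if |X i ω| ≤ δ then 1 else 0)) +
      2 / δ * (|sampleMean n (X · ω)| * |X i ω| + |sampleMean n (X · ω)| * |X (i + 1) ω|) +
      |sampleMean n (X · ω)|) P := by
  have hm := (memLp_sampleMean (P := P) hlaw n).abs
  exact ((((integral_abs_mul_indicator hind hlaw (by omega) δ).1.const_mul 2).add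
    ((integral_abs_mul_indicator hind hlaw (by omega) δ).1.const_mul 2)).add
    (((hm.integrable_mul (memLp_gaussian_seq hlaw i).abs).add
      (hm.integrable_mul (memLp_gaussian_seq hlaw (i + 1)).abs)).const_mul _)).add
    (hm.integrable (by norm_num))

include hX hind hlaw in
lemma integral_centeringError_summand_le {n : ℕ} (hn : 0 < n) (i : ℕ) {δ : ℝ} (hδ : 0 < δ) :
    ∫ ω, (2 * (|X i ω| * (if |X (i + 1) ω| ≤ δ then 1 else 0)) +
      2 * (|X (i + 1) ω| * (if |X i ω| ≤ δ then 1 else 0)) +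
      2 / δ * (|sampleMean n (X · ω)| * |X i ω| + |sampleMean n (X · ω)| * |X (i + 1) ω|) +
      |sampleMean n (X · ω)|) ∂P ≤
    4 * (gaussianAbsMean * gaussianSmallBall δ) + 4 / δ * (√n)⁻¹ + (√n)⁻¹ := by
  have hm := (memLp_sampleMean (P := P) hlaw n).abs
  obtain ⟨i1, e1⟩ := integral_abs_mul_indicator hind hlaw (show i ≠ i + 1 by omega) δ
  obtain ⟨i2, e2⟩ := integral_abs_mul_indicator hind hlaw (show i + 1 ≠ i by omega) δ
  have i3 : Integrable (fun ω ↦ |sampleMean n (X · ω)| * |X i ω|) P :=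
    hm.integrable_mul (memLp_gaussian_seq hlaw i).abs
  have i4 : Integrable (fun ω ↦ |sampleMean n (X · ω)| * |X (i + 1) ω|) P :=
    hm.integrable_mul (memLp_gaussian_seq hlaw (i + 1)).abs
  have i5 : Integrable (fun ω ↦ |sampleMean n (X · ω)|) P := hm.integrable (by norm_num)
  have h3 := integral_abs_sampleMean_mul_abs_le hX hind hlaw hn i
  have h4 := integral_abs_sampleMean_mul_abs_le hX hind hlaw hn (i + 1)
  have h5 := integral_abs_sampleMean_le hX hind hlaw n
  rw [integral_add (by fun_prop) i5, integral_add (by fun_prop) (by fun_prop),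
    integral_add (by fun_prop) (by fun_prop), integral_const_mul, integral_const_mul,
    integral_const_mul, integral_add i3 i4, e1, e2]
  have h6 : 2 / δ * (∫ ω, |sampleMean n (X · ω)| * |X i ω| ∂P +
      ∫ ω, |sampleMean n (X · ω)| * |X (i + 1) ω| ∂P) ≤ 2 / δ * ((√n)⁻¹ + (√n)⁻¹) := by gcongr
  have h7 : 2 / δ * ((√(n : ℝ))⁻¹ + (√n)⁻¹) = 4 / δ * (√n)⁻¹ := by ring
  linarith

include hX hind hlaw in
-- The sign is centered by symmetry, so these are orthogonal pair terms with d = 0, and their sums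
-- are of order √n rather than n. General index maps cover both orders of neighbours.
lemma integral_sum_abs_mul_sign_sq (s : Finset ℕ) (e f : ℕ → ℕ) (hef : ∀ k ∈ s, e k ≠ f k)
    (hs : ∀ k ∈ s, ∀ l ∈ s, k ≠ l →
      (e k ≠ f l ∧ f k ≠ f l) ∨ (e l ≠ f k ∧ f l ≠ f k)) :
    ∫ ω, (∑ k ∈ s, |X (e k) ω| * (X (f k) ω).sign) ^ 2 ∂P =
      s.card * pairVariance (fun x ↦ |x|) Real.sign (fun _ ↦ 0) (gaussianReal 0 1) := by
  have h := integral_sum_pairTerm_sq (a := fun x ↦ |x|) (b := Real.sign) (d := fun _ ↦ 0)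
    hX hind hlaw (by fun_prop) measurable_realSign measurable_const memLp_abs_gaussianReal
    memLp_realSign_gaussianReal (memLp_const _) integral_realSign_gaussianReal (by simp) s e f hef hs
  simpa only [pairTerm, add_zero] using h

omit [IsProbabilityMeasure P] in
include hind hlaw in
lemma memLp_abs_mul_sign {i j : ℕ} (hij : i ≠ j) :
    MemLp (fun ω ↦ |X i ω| * (X j ω).sign) 2 P :=
  ((hind.indepFun hij).comp (φ := fun x ↦ |x|) (ψ := Real.sign) (by fun_prop)
    measurable_realSign).memLp_two_mul (memLp_comp_of_hasLaw hlaw memLp_abs_gaussianReal i)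
    (memLp_comp_of_hasLaw hlaw memLp_realSign_gaussianReal j)

include hind hlaw in
lemma integrable_centeringError (n : ℕ) (δ : ℝ) :
    Integrable (fun ω ↦ centeringError n δ (X · ω)) P := by
  unfold centeringError
  refine Integrable.div_const (((Integrable.abs ?_).add (Integrable.abs ?_)).add ?_) _
  · exact integrable_finsetSum _ fun i _ ↦
      (memLp_abs_mul_sign hind hlaw (by omega)).integrable (by norm_num)
  · exact integrable_finsetSum _ fun i _ ↦
      (memLp_abs_mul_sign hind hlaw (by omega)).integrable (by norm_num)
  · exact integrable_finsetSum _ fun i _ ↦ integrable_centeringError_summand hind hlaw n i δ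

include hX hind hlaw in
lemma integral_centeringError_le {n : ℕ} (hn : 0 < n) {δ : ℝ} (hδ : 0 < δ) :
    ∫ ω, centeringError n δ (X · ω) ∂P ≤
      2 * √(pairVariance (fun x ↦ |x|) Real.sign (fun _ ↦ 0) (gaussianReal 0 1)) * (√n)⁻¹ +
      (4 * (gaussianAbsMean * gaussianSmallBall δ) + 4 / δ * (√n)⁻¹ + (√n)⁻¹) := by
  have hn' : (0 : ℝ) < n := by exact_mod_cast hn
  have hV : 0 ≤ pairVariance (fun x ↦ |x|) Real.sign (fun _ ↦ 0) (gaussianReal 0 1) := by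
    have h := integral_sum_abs_mul_sign_sq hX hind hlaw {0} (fun k ↦ k) (fun k ↦ k + 1) (by simp)
      (by simp)
    simp only [Finset.card_singleton, Nat.cast_one, one_mul] at h
    rw [← h]
    positivity
  have hcard : (Finset.range (n - 1)).card ≤ n := by simp
  have h1 := integral_abs_sum_le (P := P) (s := Finset.range (n - 1))
    (Z := fun i ω ↦ |X i ω| * (X (i + 1) ω).sign)
    (fun i _ ↦ memLp_abs_mul_sign hind hlaw (by omega))
    (integral_sum_abs_mul_sign_sq hX hind hlaw _ (fun k ↦ k) (fun k ↦ k + 1) (by simp)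
      (fun k _ l _ hkl ↦ by omega)) hcard hV
  have h2 := integral_abs_sum_le (P := P) (s := Finset.range (n - 1))
    (Z := fun i ω ↦ |X (i + 1) ω| * (X i ω).sign)
    (fun i _ ↦ memLp_abs_mul_sign hind hlaw (by omega))
    (integral_sum_abs_mul_sign_sq hX hind hlaw _ (fun k ↦ k + 1) (fun k ↦ k) (by simp)
      (fun k _ l _ hkl ↦ by omega)) hcard hV
  have i1 : Integrable (fun ω ↦ |∑ i ∈ Finset.range (n - 1), |X i ω| * (X (i + 1) ω).sign|) P :=
    (integrable_finsetSum _ fun i _ ↦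
      (memLp_abs_mul_sign hind hlaw (by omega)).integrable (by norm_num)).abs
  have i2 : Integrable (fun ω ↦ |∑ i ∈ Finset.range (n - 1), |X (i + 1) ω| * (X i ω).sign|) P :=
    (integrable_finsetSum _ fun i _ ↦
      (memLp_abs_mul_sign hind hlaw (by omega)).integrable (by norm_num)).abs
  have i12 : Integrable (fun ω ↦ |∑ i ∈ Finset.range (n - 1), |X i ω| * (X (i + 1) ω).sign| +
      |∑ i ∈ Finset.range (n - 1), |X (i + 1) ω| * (X i ω).sign|) P := i1.add i2
  have hi := fun i ↦ integrable_centeringError_summand hind hlaw n i δ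
  simp only [centeringError]
  rw [integral_div, integral_add i12 (integrable_finsetSum _ fun i _ ↦ hi i),
    integral_add i1 i2, integral_finsetSum _ fun i _ ↦ hi i, add_div, add_div]
  have h3 := Finset.sum_le_card_nsmul (Finset.range (n - 1)) _ _ fun i _ ↦
    integral_centeringError_summand_le hX hind hlaw hn i hδ
  have hpos : 0 ≤ 4 * (gaussianAbsMean * gaussianSmallBall δ) + 4 / δ * (√n)⁻¹ + (√(n : ℝ))⁻¹ :=
    (integral_nonneg fun ω ↦ by
      simp only [Pi.zero_apply]; positivity).trans
      (integral_centeringError_summand_le hX hind hlaw hn 0 hδ)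
  have h4 : ((Finset.range (n - 1)).card : ℝ) ≤ n := by exact_mod_cast hcard
  rw [nsmul_eq_mul] at h3
  have h5 := div_le_div_of_nonneg_right (h3.trans (mul_le_mul_of_nonneg_right h4 hpos)) hn'.le
  rw [mul_div_cancel_left₀ _ hn'.ne'] at h5
  linarith

end GaussianSequence

/-! ### Limit theorem for the centered Gaussian sequence -/

section CenteredGaussianCLT

variable {Ω : Type*} [MeasurableSpace Ω] {P : Measure Ω} [IsProbabilityMeasure P]
  {X : ℕ → Ω → ℝ} (hX : ∀ i, Measurable (X i)) (hind : iIndepFun X P)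
  (hlaw : ∀ i, HasLaw (X i) (gaussianReal 0 1) P)

lemma tendsto_inv_sqrt_natCast : Tendsto (fun n : ℕ ↦ (√(n : ℝ))⁻¹) atTop (nhds 0) :=
  tendsto_inv_atTop_zero.comp (Real.tendsto_sqrt_atTop.comp tendsto_natCast_atTop_atTop)

lemma measurable_sampleMean (n : ℕ) : Measurable (sampleMean n) := by
  unfold sampleMean
  fun_prop

lemma measurable_bivariationSum (n : ℕ) : Measurable (bivariationSum n) := by
  unfold bivariationSum
  fun_prop

lemma measurable_squareSum (n : ℕ) : Measurable (squareSum n) := by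
  unfold squareSum
  fun_prop

lemma measurable_sub_sampleMean (n : ℕ) :
    Measurable (fun (x : ℕ → ℝ) i ↦ x i - sampleMean n x) := by
  have := measurable_sampleMean n
  fun_prop

include hX hind hlaw in
lemma tendstoInMeasure_bivariationSum_sub :
    TendstoInMeasure P (fun (n : ℕ) ω ↦ (√n)⁻¹ *
      (bivariationSum n (fun i ↦ X i ω - sampleMean n (X · ω)) - bivariationSum n (X · ω)))
      atTop 0 := by
  -- The cutoff δ = n^{-1/4} tends to zero, so that the small ball loses its mass, but slowly enough
  -- that n^{-1/2}/δ = n^{-1/4} still vanishes.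
  have hδ : Tendsto (fun n : ℕ ↦ (√√(n : ℝ))⁻¹) atTop (nhds 0) :=
    tendsto_inv_atTop_zero.comp (Real.tendsto_sqrt_atTop.comp
      (Real.tendsto_sqrt_atTop.comp tendsto_natCast_atTop_atTop))
  refine tendstoInMeasure_zero_of_abs_le_mul (C := 1)
    (U := fun (n : ℕ) ω ↦ √n * |sampleMean n (X · ω)|)
    (H := fun (n : ℕ) ω ↦ centeringError n (√√(n : ℝ))⁻¹ (X · ω))
    (h := fun n ↦
      2 * √(pairVariance (fun x ↦ |x|) Real.sign (fun _ ↦ 0) (gaussianReal 0 1)) * (√n)⁻¹ +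
      (4 * (gaussianAbsMean * gaussianSmallBall (√√(n : ℝ))⁻¹) + 4 * (√√(n : ℝ))⁻¹ + (√n)⁻¹))
    ?_ (fun n ω ↦ by positivity) (fun n ω ↦ centeringError_nonneg n (by positivity) _)
    (fun n ↦ ((memLp_sampleMean hlaw n).abs.integrable (by norm_num)).const_mul _)
    (fun n ↦ integrable_centeringError hind hlaw n _) (fun n ↦ ?_) ?_ ?_
  · filter_upwards [eventually_gt_atTop 0] with n hn ω
    exact abs_bivariationSum_sub_le (by positivity) _
  · rw [integral_const_mul]
    refine (mul_le_mul_of_nonneg_left (integral_abs_sampleMean_le hX hind hlaw n)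
      (Real.sqrt_nonneg _)).trans ?_
    rw [← div_eq_mul_inv]
    exact div_self_le_one _
  · filter_upwards [eventually_gt_atTop 0] with n hn
    refine (integral_centeringError_le hX hind hlaw hn (by positivity)).trans (le_of_eq ?_)
    have h3 : 4 / (√√(n : ℝ))⁻¹ * (√n)⁻¹ = 4 * (√√(n : ℝ))⁻¹ := by
      rw [div_inv_eq_mul, mul_assoc, ← div_eq_mul_inv, Real.sqrt_div_self', one_div]
    rw [h3]
  · have h1 := (tendsto_inv_sqrt_natCast.const_mul
      (2 * √(pairVariance (fun x ↦ |x|) Real.sign (fun _ ↦ 0) (gaussianReal 0 1)))).add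
      (((((tendsto_gaussianSmallBall hδ).const_mul gaussianAbsMean).const_mul 4).add
        (hδ.const_mul 4)).add tendsto_inv_sqrt_natCast)
    simpa using h1

include hX hind hlaw in
-- The boundary terms are bounded in mean, and so is n times the squared sample mean that centering
-- removes from the sum of squares. Division by √n kills both.
lemma tendstoInMeasure_boundary :
    TendstoInMeasure P (fun (n : ℕ) ω ↦ (√n)⁻¹ * (bivariationSum n (X · ω) -
      gaussianAbsMean ^ 2 * squareSum n (fun i ↦ X i ω - sampleMean n (X · ω)) -
      ∑ i ∈ Finset.range n, pairTerm centeredAbs centeredAbs linearPart X i (i + 1) ω))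
      atTop 0 := by
  have hW : ∀ i, MemLp (pairTerm centeredAbs centeredAbs linearPart X i (i + 1)) 2 P := fun i ↦
    memLp_pairTerm hind hlaw measurable_centeredAbs measurable_centeredAbs memLp_centeredAbs
      memLp_centeredAbs memLp_linearPart (by omega)
  have hWi : ∀ i, Integrable
      (fun ω ↦ |pairTerm centeredAbs centeredAbs linearPart X i (i + 1) ω|) P := fun i ↦
    (hW i).abs.integrable (by norm_num)
  have hxi : ∀ i, Integrable (fun ω ↦ |X i ω|) P := fun i ↦
    (memLp_gaussian_seq hlaw i).abs.integrable (by norm_num)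
  have hx2 : Integrable (fun ω ↦ X 0 ω ^ 2) P := (memLp_gaussian_seq hlaw 0).integrable_sq
  have hm2 : ∀ n, Integrable (fun ω ↦ sampleMean n (X · ω) ^ 2) P := fun n ↦
    (memLp_sampleMean hlaw n).integrable_sq
  have ha : 0 < gaussianAbsMean := by unfold gaussianAbsMean; positivity
  set v := pairVariance centeredAbs centeredAbs linearPart (gaussianReal 0 1) with hv
  refine tendstoInMeasure_zero_of_abs_le
    (H := fun (n : ℕ) ω ↦ gaussianAbsMean ^ 2 * √n * sampleMean n (X · ω) ^ 2 +
      (√n)⁻¹ * (|pairTerm centeredAbs centeredAbs linearPart X (n - 1) (n - 1 + 1) ω| +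
        gaussianAbsMean * |X (n - 1) ω| + gaussianAbsMean * |X 0 ω| +
        gaussianAbsMean ^ 2 * X 0 ω ^ 2))
    (h := fun n ↦ (gaussianAbsMean ^ 2 + (√v + gaussianAbsMean * gaussianAbsMean +
      gaussianAbsMean * gaussianAbsMean + gaussianAbsMean ^ 2 * 1)) * (√n)⁻¹)
    ?_ (fun n ↦ by fun_prop) (Eventually.of_forall fun n ↦ ?_) ?_
  · filter_upwards [eventually_gt_atTop 0] with n hn ω
    obtain ⟨k, rfl⟩ : ∃ k, n = k + 1 := ⟨n - 1, by omega⟩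
    have h1 := bivariationSum_sub_squareSum_eq hn (X · ω)
    have hs : (√((k + 1 : ℕ) : ℝ))⁻¹ * (k + 1 : ℕ) = √(k + 1 : ℕ) := by
      rw [inv_mul_eq_div, Real.div_sqrt]
    rw [squareSum_sub_sampleMean hn]
    simp only [Nat.add_sub_cancel] at h1 ⊢
    set W := pairTerm centeredAbs centeredAbs linearPart X k (k + 1) ω with hWdef
    have e : (√((k + 1 : ℕ) : ℝ))⁻¹ * (bivariationSum (k + 1) (X · ω) -
        gaussianAbsMean ^ 2 * (squareSum (k + 1) (X · ω) -
          (k + 1 : ℕ) * sampleMean (k + 1) (X · ω) ^ 2) -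
        ∑ i ∈ Finset.range (k + 1), pairTerm centeredAbs centeredAbs linearPart X i (i + 1) ω) =
        gaussianAbsMean ^ 2 * √(k + 1 : ℕ) * sampleMean (k + 1) (X · ω) ^ 2 +
        (√((k + 1 : ℕ) : ℝ))⁻¹ * (-W - gaussianAbsMean * |X k ω| + gaussianAbsMean * |X 0 ω| -
          gaussianAbsMean ^ 2 * X 0 ω ^ 2) := by
      rw [hWdef]
      unfold pairTerm
      linear_combination (√((k + 1 : ℕ) : ℝ))⁻¹ * h1 +
        gaussianAbsMean ^ 2 * sampleMean (k + 1) (X · ω) ^ 2 * hs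
    rw [e]
    refine (abs_add_le _ _).trans (add_le_add (le_of_eq (abs_of_nonneg (by positivity))) ?_)
    rw [abs_mul, abs_of_nonneg (by positivity : 0 ≤ (√((k + 1 : ℕ) : ℝ))⁻¹)]
    refine mul_le_mul_of_nonneg_left (abs_le.2 ⟨?_, ?_⟩) (by positivity)
    · have h2 := le_abs_self W
      have h3 : 0 ≤ gaussianAbsMean * |X 0 ω| := by positivity
      linarith
    · have h2 := neg_abs_le W
      have h3 : 0 ≤ gaussianAbsMean * |X k ω| := by positivity
      have h4 : 0 ≤ gaussianAbsMean ^ 2 * X 0 ω ^ 2 := by positivity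
      linarith
  · have hWn := hWi (n - 1)
    have hxn := hxi (n - 1)
    have hx0 := hxi 0
    have hm := hm2 n
    have hE : ∫ ω, |pairTerm centeredAbs centeredAbs linearPart X (n - 1) (n - 1 + 1) ω| ∂P ≤ √v := by
      refine (integral_abs_le_sqrt_integral_sq (hW _)).trans (le_of_eq ?_)
      rw [integral_pairTerm_sq hind hlaw measurable_centeredAbs measurable_centeredAbs
        measurable_linearPart memLp_centeredAbs memLp_centeredAbs memLp_linearPart (by omega)]
    rw [integral_add (by fun_prop) (by fun_prop), integral_const_mul, integral_const_mul,
      integral_add (by fun_prop) (by fun_prop), integral_add (by fun_prop) (by fun_prop),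
      integral_add hWn (by fun_prop), integral_const_mul, integral_const_mul, integral_const_mul,
      integral_comp_of_hasLaw (f := fun x ↦ |x|) hlaw (by fun_prop),
      integral_comp_of_hasLaw (f := fun x ↦ |x|) hlaw (by fun_prop),
      integral_comp_of_hasLaw (f := fun x ↦ x ^ 2) hlaw (by fun_prop),
      integral_abs_gaussianReal, integral_sq_gaussianReal, integral_sampleMean_sq hX hind hlaw]
    have e : gaussianAbsMean ^ 2 * √(n : ℝ) * (n : ℝ)⁻¹ = gaussianAbsMean ^ 2 * (√n)⁻¹ := by
      rw [mul_assoc, ← div_eq_mul_inv, Real.sqrt_div_self', one_div]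
    rw [e, add_mul, mul_comm _ (√(n : ℝ))⁻¹, mul_comm _ (√(n : ℝ))⁻¹]
    gcongr
  · simpa using tendsto_inv_sqrt_natCast.const_mul _

include hX hind hlaw in
-- A law of large numbers in mean: the terms X_i² - 1 are orthogonal, and the squared sample mean
-- has expectation 1/n.
lemma tendstoInMeasure_squareSum_div :
    TendstoInMeasure P
      (fun (n : ℕ) ω ↦ squareSum n (fun i ↦ X i ω - sampleMean n (X · ω)) / n) atTop (fun _ ↦ 1) := by
  have hd2 : MemLp (fun x : ℝ ↦ x ^ 2 - 1) 2 (gaussianReal 0 1) :=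
    memLp_sq_gaussianReal.sub (memLp_const _)
  have hdX := fun i ↦ memLp_comp_of_hasLaw hlaw hd2 i
  have hm2 : ∀ n, Integrable (fun ω ↦ sampleMean n (X · ω) ^ 2) P := fun n ↦
    (memLp_sampleMean hlaw n).integrable_sq
  have hS : ∀ n : ℕ, Integrable (fun ω ↦ |∑ i ∈ Finset.range n, (X i ω ^ 2 - 1)|) P := fun n ↦
    (integrable_finsetSum _ fun i _ ↦ (hdX i).integrable (by norm_num)).abs
  have h := tendstoInMeasure_zero_of_abs_le (P := P)
    (D := fun (n : ℕ) ω ↦ squareSum n (fun i ↦ X i ω - sampleMean n (X · ω)) / n - 1)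
    (H := fun (n : ℕ) ω ↦ |∑ i ∈ Finset.range n, (X i ω ^ 2 - 1)| / n + sampleMean n (X · ω) ^ 2)
    (h := fun n ↦ √(∫ x, (x ^ 2 - 1) ^ 2 ∂(gaussianReal 0 1)) * (√n)⁻¹ + (n : ℝ)⁻¹)
    ?_ (fun n ↦ ((hS n).div_const _).add (hm2 n)) (Eventually.of_forall fun n ↦ ?_) ?_
  · rw [tendstoInMeasure_iff_norm] at h ⊢
    simpa using h
  · filter_upwards [eventually_gt_atTop 0] with n hn ω
    have hn' : (0 : ℝ) < n := by exact_mod_cast hn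
    have e : squareSum n (fun i ↦ X i ω - sampleMean n (X · ω)) / n - 1 =
        (∑ i ∈ Finset.range n, (X i ω ^ 2 - 1)) / n - sampleMean n (X · ω) ^ 2 := by
      rw [squareSum_sub_sampleMean hn, Finset.sum_sub_distrib, squareSum]
      simp
      field_simp
      ring
    rw [e]
    refine (abs_sub _ _).trans (le_of_eq ?_)
    rw [abs_div, abs_of_pos hn', abs_of_nonneg (sq_nonneg (sampleMean n (X · ω)))]
  · rw [integral_add ((hS n).div_const _) (hm2 n), integral_div, integral_sampleMean_sq hX hind hlaw]
    have h1 := integral_abs_sum_le (P := P) (s := Finset.range n)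
      (Z := fun i ω ↦ X i ω ^ 2 - 1) (fun i _ ↦ hdX i)
      (integral_sum_comp_sq hX hind hlaw (by fun_prop) hd2 integral_sq_sub_one n) (n := n)
      (by simp) (by positivity)
    linarith
  · simpa using (tendsto_inv_sqrt_natCast.const_mul
      √(∫ x, (x ^ 2 - 1) ^ 2 ∂(gaussianReal 0 1))).add (tendsto_inv_atTop_nhds_zero_nat (𝕜 := ℝ))

include hX hind hlaw in
lemma tendstoInDistribution_centered_numerator :
    TendstoInDistribution (fun (n : ℕ) ω ↦ (√n)⁻¹ *
      (bivariationSum n (fun i ↦ X i ω - sampleMean n (X · ω)) -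
        gaussianAbsMean ^ 2 * squareSum n (fun i ↦ X i ω - sampleMean n (X · ω))))
      atTop (fun z : ℝ ↦ z) (fun _ ↦ P) (gaussianReal 0 limitVariance) := by
  have hCLT := tendstoInDistribution_sum_pairTerm hX hind hlaw measurable_centeredAbs
    measurable_centeredAbs measurable_linearPart memLp_centeredAbs memLp_centeredAbs
    memLp_linearPart integral_centeredAbs integral_linearPart
  have hv : (pairVariance centeredAbs centeredAbs linearPart (gaussianReal 0 1)).toNNReal =
      limitVariance := by
    rw [pairVariance_centeredAbs]
    exact Real.toNNReal_of_nonneg limitVariance_nonneg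
  rw [hv] at hCLT
  have hmX : Measurable (fun ω i ↦ X i ω) := by fun_prop
  have hB := fun n ↦ (measurable_bivariationSum n).comp hmX
  have hB' := fun n ↦ (measurable_bivariationSum n).comp ((measurable_sub_sampleMean n).comp hmX)
  have hQ' := fun n ↦ (measurable_squareSum n).comp ((measurable_sub_sampleMean n).comp hmX)
  -- The intermediate sequence has the raw bivariation but already the centered sum of squares.
  have h1 := tendstoInDistribution_of_tendstoInMeasure_sub
    (fun (n : ℕ) ω ↦ (√n)⁻¹ * (bivariationSum n (X · ω) -
      gaussianAbsMean ^ 2 * squareSum n (fun i ↦ X i ω - sampleMean n (X · ω))))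
    (fun z : ℝ ↦ z) hCLT ?_
    (fun n ↦ (((hB n).sub ((hQ' n).const_mul _)).const_mul _).aemeasurable)
  · refine tendstoInDistribution_of_tendstoInMeasure_sub _ (fun z : ℝ ↦ z) h1 ?_
      (fun n ↦ (((hB' n).sub ((hQ' n).const_mul _)).const_mul _).aemeasurable)
    refine (tendstoInMeasure_bivariationSum_sub hX hind hlaw).congr_left fun n ↦
      ae_of_all _ fun ω ↦ ?_
    simp only [Pi.sub_apply]
    ring
  · refine (tendstoInMeasure_boundary hX hind hlaw).congr_left fun n ↦ ae_of_all _ fun ω ↦ ?_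
    simp only [Pi.sub_apply]
    ring

/-- The normalized bivariation statistic of the first `n` terms of a sequence, after centering. -/
noncomputable def centeredBivariationStat (n : ℕ) (x : ℕ → ℝ) : ℝ :=
  √(n : ℝ) * (bivariationSum n (fun i ↦ x i - sampleMean n x) /
    squareSum n (fun i ↦ x i - sampleMean n x) - 2 / Real.pi)

lemma measurable_centeredBivariationStat (n : ℕ) : Measurable (centeredBivariationStat n) :=
  ((((measurable_bivariationSum n).comp (measurable_sub_sampleMean n)).div
    ((measurable_squareSum n).comp (measurable_sub_sampleMean n))).sub_const _).const_mul _

lemma centeredBivariationStat_eq {n : ℕ} (hn : 0 < n) {x : ℕ → ℝ}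
    (hx : squareSum n (fun i ↦ x i - sampleMean n x) ≠ 0) :
    centeredBivariationStat n x = (√n)⁻¹ * (bivariationSum n (fun i ↦ x i - sampleMean n x) -
        gaussianAbsMean ^ 2 * squareSum n (fun i ↦ x i - sampleMean n x)) *
      (squareSum n (fun i ↦ x i - sampleMean n x) / n)⁻¹ := by
  have hn' : (0 : ℝ) < n := by exact_mod_cast hn
  have hs : 0 < √(n : ℝ) := Real.sqrt_pos.2 hn'
  have hss : (n : ℝ) = √(n : ℝ) ^ 2 := (Real.sq_sqrt hn'.le).symm
  rw [centeredBivariationStat, gaussianAbsMean_sq, inv_div]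
  generalize bivariationSum n (fun i ↦ x i - sampleMean n x) = B
  generalize squareSum n (fun i ↦ x i - sampleMean n x) = Q at hx ⊢
  have h1 : B / Q - 2 / Real.pi = (B - 2 / Real.pi * Q) / Q := by field_simp
  have h2 : (√(n : ℝ))⁻¹ * n = √n := by rw [inv_mul_eq_div, Real.div_sqrt]
  calc √(n : ℝ) * (B / Q - 2 / Real.pi) = ((√(n : ℝ))⁻¹ * n) * ((B - 2 / Real.pi * Q) / Q) := by
        rw [h1, h2]
    _ = _ := by ring

include hX hind hlaw in
theorem tendstoInDistribution_centeredBivariationStat :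
    TendstoInDistribution (fun (n : ℕ) ω ↦ centeredBivariationStat n (X · ω))
      atTop (fun z : ℝ ↦ z) (fun _ ↦ P) (gaussianReal 0 limitVariance) := by
  have hN := tendstoInDistribution_centered_numerator hX hind hlaw
  have hQ := tendstoInMeasure_squareSum_div hX hind hlaw
  have hmX : Measurable (fun ω i ↦ X i ω) := by fun_prop
  have hB' := fun n ↦ (measurable_bivariationSum n).comp ((measurable_sub_sampleMean n).comp hmX)
  have hQ' := fun n ↦ (measurable_squareSum n).comp ((measurable_sub_sampleMean n).comp hmX)
  have hQm : ∀ n : ℕ, Measurable (fun ω ↦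
      (squareSum n (fun i ↦ X i ω - sampleMean n (X · ω)) / n)⁻¹) := fun n ↦
    ((hQ' n).div_const _).inv
  have hNm : ∀ n : ℕ, Measurable (fun ω ↦ (√n)⁻¹ *
      (bivariationSum n (fun i ↦ X i ω - sampleMean n (X · ω)) -
        gaussianAbsMean ^ 2 * squareSum n (fun i ↦ X i ω - sampleMean n (X · ω)))) := fun n ↦
    ((hB' n).sub ((hQ' n).const_mul _)).const_mul _
  have hTm : ∀ n : ℕ, Measurable (fun ω ↦ centeredBivariationStat n (X · ω)) := fun n ↦
    (measurable_centeredBivariationStat n).comp hmX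
  have hQinv : TendstoInMeasure P (fun (n : ℕ) ω ↦
      (squareSum n (fun i ↦ X i ω - sampleMean n (X · ω)) / n)⁻¹) atTop (fun _ ↦ 1) := by
    refine tendstoInMeasure_of_forall_subseq hQ (fun n ↦ (hQm n).aestronglyMeasurable)
      fun ω ns _ h ↦ ?_
    simpa using h.inv₀ one_ne_zero
  have h1 := hN.continuous_comp_prodMk_of_tendstoInMeasure_const
    (g := fun p : ℝ × ℝ ↦ p.1 * p.2) (by fun_prop) hQinv (fun n ↦ (hQm n).aemeasurable)
  simp only [mul_one] at h1
  refine tendstoInDistribution_of_tendstoInMeasure_sub _ (fun z : ℝ ↦ z) h1 ?_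
    (fun n ↦ (hTm n).aemeasurable)
  -- The factorization of the statistic can fail only where the sum of squares vanishes. Where Q/n →
  -- 1 along a subsequence, the difference is therefore eventually zero.
  refine tendstoInMeasure_of_forall_subseq (e := 0) hQ
    (fun n ↦ ((hTm n).sub ((hNm n).mul (hQm n))).aestronglyMeasurable) fun ω ns hns h ↦ ?_
  refine tendsto_const_nhds.congr' ?_
  filter_upwards [hns.eventually_gt_atTop 0, h.eventually_ne one_ne_zero] with k hk hne
  simp only [Pi.sub_apply]
  rw [centeredBivariationStat_eq hk (fun h0 ↦ hne (by rw [h0, zero_div])), sub_self]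

end CenteredGaussianCLT

/-! ### From the Brownian bridge to i.i.d. Gaussian variables -/

section Transfer

variable {Ω : Type*} [MeasurableSpace Ω] {P : Measure Ω} {Y : I → Ω → ℝ}

lemma monotone_gridPoint (n : ℕ) : Monotone (gridPoint n) := fun i j hij ↦
  Set.monotone_projIcc _ (by gcongr)

lemma gridPoint_zero (n : ℕ) : gridPoint n 0 = 0 := by
  apply Subtype.ext
  rw [coe_gridPoint (Nat.zero_le n)]
  simp

lemma gridPoint_self {n : ℕ} (hn : 0 < n) : gridPoint n n = 1 := by
  apply Subtype.ext
  rw [coe_gridPoint le_rfl, div_self (by exact_mod_cast hn.ne')]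
  rfl

/-- The increments of a path over a grid, rescaled to unit variance, as a sequence. -/
noncomputable def scaledIncrement (n : ℕ) (x : I → ℝ) (i : ℕ) : ℝ :=
  √(n : ℝ) * gridIncrement n x (i + 1)

lemma sampleMean_scaledIncrement {n : ℕ} (hn : 0 < n) {x : I → ℝ} (h0 : x 0 = 0) :
    sampleMean n (scaledIncrement n x) = √(n : ℝ) * (x 1 / n) := by
  simp only [sampleMean, scaledIncrement, gridIncrement, Nat.add_sub_cancel]
  rw [← Finset.mul_sum, Finset.sum_range_sub (fun i ↦ x (gridPoint n i)), gridPoint_self hn,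
    gridPoint_zero, h0]
  ring

/-- The increments telescope to x 1, so their rescaled mean is √n x(1)/n, exactly what the drift t
x(1) takes from each rescaled increment. -/
lemma scaledIncrement_bridgeMap {n i : ℕ} (hi : i < n) {x : I → ℝ} (h0 : x 0 = 0) :
    scaledIncrement n x i - sampleMean n (scaledIncrement n x) =
      √(n : ℝ) * gridIncrement n (bridgeMap x) (i + 1) := by
  rw [sampleMean_scaledIncrement (by omega) h0]
  simp only [scaledIncrement, gridIncrement, bridgeMap, Nat.add_sub_cancel]
  rw [coe_gridPoint (by omega), coe_gridPoint (by omega)]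
  push_cast
  ring

lemma normalizedBivariation_bridgeMap {n : ℕ} (hn : 0 < n) {x : I → ℝ} (h0 : x 0 = 0) :
    √(n : ℝ) * (normalizedBivariation n (bridgeMap x) - 2 / Real.pi) =
      centeredBivariationStat n (scaledIncrement n x) := by
  have hn' : (0 : ℝ) < n := by exact_mod_cast hn
  have hss : √(n : ℝ) * √n = n := Real.mul_self_sqrt hn'.le
  have hB : bivariationSum n
      (fun i ↦ scaledIncrement n x i - sampleMean n (scaledIncrement n x)) =
      n * realizedBivariation n (bridgeMap x) := by
    rw [bivariationSum, realizedBivariation, ← Finset.Ico_add_one_right_eq_Icc,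
      Finset.sum_Ico_eq_sum_range, Finset.mul_sum]
    refine Finset.sum_congr (by simp) fun i hi ↦ ?_
    simp only [Finset.mem_range] at hi
    rw [scaledIncrement_bridgeMap (by omega) h0, scaledIncrement_bridgeMap (by omega) h0, abs_mul,
      abs_mul, abs_of_nonneg (Real.sqrt_nonneg _), add_comm 1 i]
    linear_combination |gridIncrement n (bridgeMap x) (i + 1)| *
      |gridIncrement n (bridgeMap x) (i + 1 + 1)| * hss
  have hQ : squareSum n
      (fun i ↦ scaledIncrement n x i - sampleMean n (scaledIncrement n x)) =
      n * realizedQuadraticVariation n (bridgeMap x) := by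
    rw [squareSum, realizedQuadraticVariation, ← Finset.Ico_add_one_right_eq_Icc,
      Finset.sum_Ico_eq_sum_range, Finset.mul_sum]
    refine Finset.sum_congr (by simp) fun i hi ↦ ?_
    simp only [Finset.mem_range] at hi
    rw [scaledIncrement_bridgeMap (by omega) h0, sq_abs, add_comm 1 i]
    linear_combination gridIncrement n (bridgeMap x) (i + 1) ^ 2 * hss
  rw [centeredBivariationStat, hB, hQ, mul_div_mul_left _ _ hn'.ne', normalizedBivariation]

/-- The first `n` terms of a sequence, extended by zero. -/
def extendByZero {n : ℕ} (v : Fin n → ℝ) (i : ℕ) : ℝ := if h : i < n then v ⟨i, h⟩ else 0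

lemma measurable_extendByZero (n : ℕ) : Measurable (extendByZero (n := n)) := by
  refine measurable_pi_lambda _ fun i ↦ ?_
  unfold extendByZero
  split_ifs <;> fun_prop

/-- The statistic reads only the first n entries, so its law is determined by that of an
n-dimensional vector. -/
lemma centeredBivariationStat_extendByZero (n : ℕ) (x : ℕ → ℝ) :
    centeredBivariationStat n (extendByZero fun i : Fin n ↦ x i) = centeredBivariationStat n x := by
  have h : ∀ i, i < n → extendByZero (fun i : Fin n ↦ x i) i = x i := fun i hi ↦ dif_pos hi
  have hm : sampleMean n (extendByZero fun i : Fin n ↦ x i) = sampleMean n x := by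
    unfold sampleMean
    rw [Finset.sum_congr rfl fun i hi ↦ h i (Finset.mem_range.1 hi)]
  unfold centeredBivariationStat bivariationSum squareSum
  rw [hm]
  congr 3
  · refine Finset.sum_congr rfl fun i hi ↦ ?_
    have := Finset.mem_range.1 hi
    simp only
    rw [h i (by omega), h (i + 1) (by omega)]
  · exact Finset.sum_congr rfl fun i hi ↦ by simp only [h i (Finset.mem_range.1 hi)]

/-- The clamped grid is monotone on all of ℕ, so independence needs no bound on i; the Gaussian law
does, since for n > 0 the increments past the endpoint are zero. -/
lemma IsBrownianOnUnit.iIndepFun_scaledIncrement (hY : IsBrownianOnUnit Y P) (n : ℕ) :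
    iIndepFun (fun i ω ↦ scaledIncrement n (fun t ↦ Y t ω) i) P :=
  (hY.indep_increments.nat (monotone_gridPoint n)).comp (fun _ x ↦ √(n : ℝ) * x)
    fun _ ↦ by fun_prop

lemma IsBrownianOnUnit.hasLaw_scaledIncrement (hY : IsBrownianOnUnit Y P) {n i : ℕ} (hi : i < n) :
    HasLaw (fun ω ↦ scaledIncrement n (fun t ↦ Y t ω) i) (gaussianReal 0 1) P := by
  have hn : (n : ℝ) ≠ 0 := by
    have : 0 < n := by omega
    exact_mod_cast this.ne'
  have h := gaussianReal_const_mul (hY.law_increment _ _ (monotone_gridPoint n i.le_succ)) √(n : ℝ)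
  convert h using 2
  · simp [scaledIncrement, gridIncrement]
  · simp
  · rw [coe_gridPoint (by omega), coe_gridPoint (by omega)]
    apply NNReal.eq
    have e : ((i + 1 : ℕ) : ℝ) / n - i / n = (n : ℝ)⁻¹ := by
      push_cast
      field_simp
      ring
    rw [Nat.succ_eq_add_one, e]
    simp [hn]

end Transfer

theorem mainTheorem4 {Ω : Type*} [MeasurableSpace Ω] (P : Measure Ω) [IsProbabilityMeasure P]
    (Y : I → Ω → ℝ) (hY : IsBrownianOnUnit Y P) :
    TendstoInDistribution
      (fun (n : ℕ) (ω : Ω) ↦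
        √(n : ℝ) * (normalizedBivariation n (bridgeMap (fun t ↦ Y t ω)) - 2 / Real.pi))
      atTop (fun z : ℝ ↦ z) (fun _ ↦ P) (gaussianReal 0 limitVariance) := by
  -- The rescaled increments change entirely with n, but convergence in distribution sees only the
  -- law for each n. Each row is replaced by the first n coordinates of one i.i.d. sequence on a
  -- product space.
  let γ : Measure (ℕ → ℝ) := Measure.infinitePi fun _ ↦ gaussianReal 0 1
  have hγi : iIndepFun (fun i (x : ℕ → ℝ) ↦ x i) γ :=
    iIndepFun_infinitePi (X := fun _ x ↦ x) fun _ ↦ measurable_id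
  have hγl : ∀ i, HasLaw (fun x : ℕ → ℝ ↦ x i) (gaussianReal 0 1) γ := fun i ↦
    ⟨(measurable_pi_apply i).aemeasurable, Measure.infinitePi_map_eval _ i⟩
  have hmain := tendstoInDistribution_centeredBivariationStat (fun i ↦ measurable_pi_apply i) hγi hγl
  have hid : ∀ n : ℕ, IdentDistrib
      (fun ω ↦ √(n : ℝ) * (normalizedBivariation n (bridgeMap (fun t ↦ Y t ω)) - 2 / Real.pi))
      (fun x : ℕ → ℝ ↦ centeredBivariationStat n (x ·)) P γ := by
    intro n
    have h1 : IdentDistrib (fun ω (i : Fin n) ↦ scaledIncrement n (fun t ↦ Y t ω) i)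
        (fun (x : ℕ → ℝ) (i : Fin n) ↦ x i) P γ :=
      IdentDistrib.pi (fun i ↦ ⟨(hY.hasLaw_scaledIncrement i.2).aemeasurable,
        (hγl i).aemeasurable, by rw [(hY.hasLaw_scaledIncrement i.2).map_eq, (hγl i).map_eq]⟩)
        ((hY.iIndepFun_scaledIncrement n).precomp Fin.val_injective)
        (hγi.precomp Fin.val_injective)
    have h2 := h1.comp ((measurable_centeredBivariationStat n).comp (measurable_extendByZero n))
    have e1 : (fun ω ↦ √(n : ℝ) * (normalizedBivariation n (bridgeMap (fun t ↦ Y t ω)) -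
        2 / Real.pi)) =ᵐ[P] (centeredBivariationStat n ∘ extendByZero) ∘
          (fun ω (i : Fin n) ↦ scaledIncrement n (fun t ↦ Y t ω) i) := by
      filter_upwards [hY.start_zero] with ω hω
      simp only [Function.comp_apply]
      rw [centeredBivariationStat_extendByZero n (scaledIncrement n fun t ↦ Y t ω)]
      -- For n = 0 both sides vanish because of the factor √0.
      rcases Nat.eq_zero_or_pos n with rfl | hn
      · simp [centeredBivariationStat]
      · exact normalizedBivariation_bridgeMap hn hω
    have e2 : (centeredBivariationStat n ∘ extendByZero) ∘
        (fun (x : ℕ → ℝ) (i : Fin n) ↦ x i) = fun x ↦ centeredBivariationStat n (x ·) := by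
      funext x
      exact centeredBivariationStat_extendByZero n x
    rw [e2] at h2
    exact (IdentDistrib.of_ae_eq (h2.aemeasurable_fst.congr e1.symm) e1).trans h2
  refine ⟨fun n ↦ (hid n).aemeasurable_fst, hmain.aemeasurable_limit, ?_⟩
  refine hmain.tendsto.congr fun n ↦ Subtype.ext ?_
  exact (hid n).map_eq.symm
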